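/- Generalized Bianchi identity for $f(T,B)$ gravity. Let $U\subseteq\mathbb{R}^4$ be open (a coordinate domain), let $h^A{}_\mu$ be a smooth tetrad on $U$ (an everywhere invertible real $4\times4$ matrix field), let $\Lambda^A{}_C$ be a smooth field of Lorentz matrices on $U$, and let $\omega^A{}_{D\mu}=\Lambda^A{}_C\,\partial_\mu(\Lambda^{-1})^C{}_D$ be the corresponding flat spin connection (the choice $\Lambda=1$ is the Weitzenböck gauge). With $\eta=\mathrm{diag}(+,-,-,-)$ put $g_{\mu\nu}=\eta_{AC}h^A{}_\mu h^C{}_\nu$; let $\nabla$, with Christoffel symbols $\mathring\Gamma$, be the Levi-Civita connection of $g$, with Riemann tensor $\mathring R^\rho{}_{\sigma\mu\nu}=\partial_\mu\mathring\Gamma^\rho_{\nu\sigma}-\partial_\nu\mathring\Gamma^\rho_{\mu\sigma}+\mathring\Gamma^\rho_{\mu\lambda}\mathring\Gamma^\lambda_{\nu\sigma}-\mathring\Gamma^\rho_{\nu\lambda}\mathring\Gamma^\lambda_{\mu\sigma}$, Ricci tensor $\mathring R_{\mu\nu}=\mathring R^\rho{}_{\mu\rho\nu}$ and Einstein tensor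 $G_{\mu\nu}=\mathring R_{\mu\nu}-\frac12\mathring R\,g_{\mu\nu}$. Define $$\Gamma^\sigma{}_{\nu\mu}=h_A{}^\sigma\left(\partial_\mu h^A{}_\nu+\omega^A{}_{D\mu}h^D{}_\nu\right),\quad T^\rho{}_{\mu\nu}=\Gamma^\rho{}_{\nu\mu}-\Gamma^\rho{}_{\mu\nu},\quad K^\rho{}_{\mu\nu}=\Gamma^\rho{}_{\mu\nu}-\mathring\Gamma^\rho{}_{\mu\nu},$$ $$S_\rho{}^{\mu\nu}=K^{\mu\nu}{}_\rho-\delta^\mu_\rho T_\sigma{}^{\sigma\nu}+\delta^\nu_\rho T_\sigma{}^{\sigma\mu},\quad T=\tfrac12S_\rho{}^{\mu\nu}T^\rho{}_{\mu\nu},\quad B=\tfrac{2}{\det h}\,\partial_\mu\left(\det h\;T_\sigma{}^{\sigma\mu}\right).$$ Let $f$ be a smooth real function on an open subset of $\mathbb{R}^2$ that contains all values $(T,B)(x)$, $x\in U$; let $f_T,f_B$ denote its partial derivatives evaluated at $(T,B)$, and put $$E_{\mu\nu}=f_TG_{\mu\nu}+\tfrac12\left(f-f_TT-f_BB\right)g_{\mu\nu}-\left(g_{\mu\nu}\square-\nabla_\mu\nabla_\nu\right)f_B+S_{\mu\nu\alpha}\,\partial^\alpha(f_T+f_B),$$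 so that $E_{\mu\nu}=0$ are the vacuum field equations of $f(T,B)$ gravity. Then: (1) on $U$, $E_{[\mu\nu]}=S_{[\mu\nu]\alpha}\,\partial^\alpha(f_T+f_B)$; (2) on $U$, without use of any field equation, $\nabla^\nu E_{\mu\nu}=K^{\alpha\beta}{}_\mu E_{\alpha\beta}$; (3) at every point of $U$ where the antisymmetric field equations $S^{[\alpha\rho]\nu}\,\partial_\nu(f_T+f_B)=0$ hold, $\nabla^\nu E_{\mu\nu}=0$; and if they hold at all points of $U$, then both $\nabla^\nu E_{\mu\nu}=0$ and $\nabla^\nu E_{\nu\mu}=0$ hold identically on $U$. This contains the known identity of $f(T)$ gravity: let $F$ be a smooth real function on an open subset of $\mathbb{R}$ that contains all values of $T$ on $U$, and put $E_{\mu\nu}=F'(T)G_{\mu\nu}+\frac12(F(T)-F'(T)\,T)g_{\mu\nu}+S_{\mu\nu\alpha}\,\partial^\alpha F'(T)$. Then the statements in (3) hold with $S^{[\alpha\rho]\nu}\,\partial_\nu F'(T)=0$ as the antisymmetric field equations. -/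

import Mathlib

open scoped ContDiff Matrix

noncomputable section

namespace Teleparallel

/-- Points of a coordinate domain of the four-dimensional spacetime. -/
abbrev Pt : Type := Fin 4 → ℝ

/-- Matrix-valued fields in coordinates. For a tetrad `h`, the entry `h x A μ` is `h^A_μ(x)`;
for a Lorentz matrix field, the entry `Λ x A C` is `Λ^A_C(x)`. -/
abbrev MatField : Type := Pt → Matrix (Fin 4) (Fin 4) ℝ

/-- The Minkowski metric `diag(+,-,-,-)`. -/
def eta : Matrix (Fin 4) (Fin 4) ℝ := Matrix.diagonal ![1, -1, -1, -1]

/-- The partial derivative `∂_μ φ`. -/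
def pd (μ : Fin 4) (φ : Pt → ℝ) : Pt → ℝ := fun x => fderiv ℝ φ x (Pi.single μ 1)

/-! ### Metric and Levi-Civita connection -/

/-- The metric `g_{μν} = η_{AC} h^A_μ h^C_ν`. -/
def metric (h : MatField) : MatField := fun x => (h x)ᵀ * eta * h x

/-- The inverse metric `g^{μν}`. -/
def invMetric (h : MatField) : MatField := fun x => (metric h x)⁻¹

/-- The Levi-Civita Christoffel symbols `Γ°^σ_{μν}` of the metric. -/
def christoffel (h : MatField) (σ μ ν : Fin 4) (x : Pt) : ℝ :=
  ∑ ρ, (1 / 2) * invMetric h x σ ρ *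
    (pd μ (fun y => metric h y ρ ν) x + pd ν (fun y => metric h y ρ μ) x
      - pd ρ (fun y => metric h y μ ν) x)

/-- The Riemann tensor `R°^ρ_{σμν}` of the Levi-Civita connection. -/
def riemann (h : MatField) (ρ σ μ ν : Fin 4) (x : Pt) : ℝ :=
  pd μ (christoffel h ρ ν σ) x - pd ν (christoffel h ρ μ σ) x
    + ∑ l, (christoffel h ρ μ l x * christoffel h l ν σ x
      - christoffel h ρ ν l x * christoffel h l μ σ x)

/-- The Ricci tensor `R°_{μν} = R°^ρ_{μρν}`. -/
def ricci (h : MatField) (μ ν : Fin 4) (x : Pt) : ℝ := ∑ ρ, riemann h ρ μ ρ ν x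

/-- The Ricci scalar `R° = g^{μν} R°_{μν}`. -/
def ricciScalar (h : MatField) (x : Pt) : ℝ := ∑ μ, ∑ ν, invMetric h x μ ν * ricci h μ ν x

/-- The Einstein tensor `G°_{μν} = R°_{μν} - ½ R° g_{μν}`. -/
def einstein (h : MatField) (μ ν : Fin 4) (x : Pt) : ℝ :=
  ricci h μ ν x - (1 / 2) * ricciScalar h x * metric h x μ ν

/-- The second Levi-Civita derivative `∇_μ ∇_ν φ` of a scalar. -/
def hess (h : MatField) (φ : Pt → ℝ) (μ ν : Fin 4) (x : Pt) : ℝ :=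
  pd μ (pd ν φ) x - ∑ σ, christoffel h σ μ ν x * pd σ φ x

/-- The d'Alembertian `□ φ = g^{μν} ∇_μ ∇_ν φ`. -/
def box (h : MatField) (φ : Pt → ℝ) (x : Pt) : ℝ :=
  ∑ μ, ∑ ν, invMetric h x μ ν * hess h φ μ ν x

/-- The Levi-Civita derivative `∇_l E_{μν}` of a tensor field with two lower indices. -/
def covD (h : MatField) (E : Fin 4 → Fin 4 → Pt → ℝ) (l μ ν : Fin 4) (x : Pt) : ℝ :=
  pd l (E μ ν) x - ∑ σ, christoffel h σ l μ x * E σ ν x - ∑ σ, christoffel h σ l ν x * E μ σ x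

/-- The Levi-Civita divergence `∇^ν E_{μν}` on the second index. -/
def divSnd (h : MatField) (E : Fin 4 → Fin 4 → Pt → ℝ) (μ : Fin 4) (x : Pt) : ℝ :=
  ∑ ν, ∑ l, invMetric h x ν l * covD h E l μ ν x

/-- The Levi-Civita divergence `∇^ν E_{νμ}` on the first index. -/
def divFst (h : MatField) (E : Fin 4 → Fin 4 → Pt → ℝ) (μ : Fin 4) (x : Pt) : ℝ :=
  ∑ ν, ∑ l, invMetric h x ν l * covD h E l ν μ x

/-! ### Teleparallel geometry -/

/-- `Λ` is Lorentz-matrix-valued on `U`. -/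
def IsLorentzOn (Λ : MatField) (U : Set Pt) : Prop := ∀ x ∈ U, (Λ x)ᵀ * eta * Λ x = eta

/-- The flat spin connection `ω^A_{Dμ} = Λ^A_C ∂_μ (Λ⁻¹)^C_D`. -/
def spinConn (Λ : MatField) (A D μ : Fin 4) (x : Pt) : ℝ :=
  ∑ C, Λ x A C * pd μ (fun y => (Λ y)⁻¹ C D) x

/-- The teleparallel connection `Γ^σ_{νμ} = h_A^σ ∂_μ h^A_ν + h_A^σ ω^A_{Dμ} h^D_ν`
(the last index is the differentiation index). -/
def teleConn (h Λ : MatField) (σ ν μ : Fin 4) (x : Pt) : ℝ :=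
  ∑ A, (h x)⁻¹ σ A * (pd μ (fun y => h y A ν) x + ∑ D, spinConn Λ A D μ x * h x D ν)

/-- The torsion tensor `T^ρ_{μν} = -2 Γ^ρ_{[μν]} = Γ^ρ_{νμ} - Γ^ρ_{μν}`. -/
def torsion (h Λ : MatField) (ρ μ ν : Fin 4) (x : Pt) : ℝ :=
  teleConn h Λ ρ ν μ x - teleConn h Λ ρ μ ν x

/-- The contortion tensor `K^ρ_{μν} = Γ^ρ_{μν} - Γ°^ρ_{μν}`. -/
def contortion (h Λ : MatField) (ρ μ ν : Fin 4) (x : Pt) : ℝ :=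
  teleConn h Λ ρ μ ν x - christoffel h ρ μ ν x

/-- The contortion tensor with its second index raised, `K^{μν}_ρ = g^{νσ} K^μ_{σρ}`. -/
def contortionUp (h Λ : MatField) (μ ν ρ : Fin 4) (x : Pt) : ℝ :=
  ∑ σ, invMetric h x ν σ * contortion h Λ μ σ ρ x

/-- The torsion vector `T_σ^{σμ} = g^{μν} T^σ_{σν}`. -/
def torsionVec (h Λ : MatField) (μ : Fin 4) (x : Pt) : ℝ :=
  ∑ ν, invMetric h x μ ν * ∑ σ, torsion h Λ σ σ ν x

/-- The superpotential `S_ρ^{μν} = K^{μν}_ρ - δ^μ_ρ T_σ^{σν} + δ^ν_ρ T_σ^{σμ}`. -/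
def superpot (h Λ : MatField) (ρ μ ν : Fin 4) (x : Pt) : ℝ :=
  contortionUp h Λ μ ν ρ x - (if μ = ρ then torsionVec h Λ ν x else 0)
    + (if ν = ρ then torsionVec h Λ μ x else 0)

/-- The superpotential with all indices raised, `S^{αμν} = g^{αρ} S_ρ^{μν}`. -/
def superpotUp (h Λ : MatField) (α μ ν : Fin 4) (x : Pt) : ℝ :=
  ∑ ρ, invMetric h x α ρ * superpot h Λ ρ μ ν x

/-- The superpotential with all indices lowered, `S_{μνα} = g_{νσ} g_{αβ} S_μ^{σβ}`. -/
def superpotLow (h Λ : MatField) (μ ν α : Fin 4) (x : Pt) : ℝ :=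
  ∑ σ, ∑ β, metric h x ν σ * metric h x α β * superpot h Λ μ σ β x

/-- The torsion scalar `T = ½ S_ρ^{μν} T^ρ_{μν}`. -/
def torsionScalar (h Λ : MatField) (x : Pt) : ℝ :=
  (1 / 2) * ∑ ρ, ∑ μ, ∑ ν, superpot h Λ ρ μ ν x * torsion h Λ ρ μ ν x

/-- The boundary term `B = (2/h) ∂_μ (h T_σ^{σμ})`, where `h` is the tetrad determinant. -/
def boundary (h Λ : MatField) (x : Pt) : ℝ :=
  2 / (h x).det * ∑ μ, pd μ (fun y => (h y).det * torsionVec h Λ μ y) x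

/-- The raised gradient `∂^α φ = g^{αβ} ∂_β φ`. -/
def gradUp (h : MatField) (φ : Pt → ℝ) (α : Fin 4) (x : Pt) : ℝ :=
  ∑ β, invMetric h x α β * pd β φ x

/-- The antisymmetric part `S^{[αρ]ν} ∂_ν φ = ½ (S^{αρν} - S^{ραν}) ∂_ν φ`. -/
def antisym (h Λ : MatField) (φ : Pt → ℝ) (α ρ : Fin 4) (x : Pt) : ℝ :=
  ∑ ν, (1 / 2) * (superpotUp h Λ α ρ ν x - superpotUp h Λ ρ α ν x) * pd ν φ x

/-! ### Field equations of `f(T,B)` and `f(T)` gravity -/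

/-- The field `f(T,B)`. -/
def fF (h Λ : MatField) (f : ℝ × ℝ → ℝ) (x : Pt) : ℝ :=
  f (torsionScalar h Λ x, boundary h Λ x)

/-- The field `f_T = (∂f/∂T)(T,B)`. -/
def fT (h Λ : MatField) (f : ℝ × ℝ → ℝ) (x : Pt) : ℝ :=
  fderiv ℝ f (torsionScalar h Λ x, boundary h Λ x) (1, 0)

/-- The field `f_B = (∂f/∂B)(T,B)`. -/
def fB (h Λ : MatField) (f : ℝ × ℝ → ℝ) (x : Pt) : ℝ :=
  fderiv ℝ f (torsionScalar h Λ x, boundary h Λ x) (0, 1)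

/-- The field `f_T + f_B`. -/
def fTB (h Λ : MatField) (f : ℝ × ℝ → ℝ) (x : Pt) : ℝ := fT h Λ f x + fB h Λ f x

/-- The left-hand side of the vacuum field equations of `f(T,B)` gravity:
`f_T G°_{μν} + ½ (f - f_T T - f_B B) g_{μν} - (g_{μν} □ - ∇_μ ∇_ν) f_B
  + S_{μνα} ∂^α (f_T + f_B)`. -/
def fieldTB (h Λ : MatField) (f : ℝ × ℝ → ℝ) (μ ν : Fin 4) (x : Pt) : ℝ :=
  fT h Λ f x * einstein h μ ν x
    + (1 / 2) * (fF h Λ f x - fT h Λ f x * torsionScalar h Λ x - fB h Λ f x * boundary h Λ x)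
      * metric h x μ ν
    - (metric h x μ ν * box h (fB h Λ f) x - hess h (fB h Λ f) μ ν x)
    + ∑ α, superpotLow h Λ μ ν α x * gradUp h (fTB h Λ f) α x

/-- The field `F'(T)` for a function `F` of the torsion scalar alone. -/
def dF (h Λ : MatField) (F : ℝ → ℝ) (x : Pt) : ℝ := deriv F (torsionScalar h Λ x)

/-- The left-hand side of the vacuum field equations of `f(T)` gravity:
`F'(T) G°_{μν} + ½ (F(T) - F'(T) T) g_{μν} + S_{μνα} ∂^α F'(T)`. -/
def fieldT (h Λ : MatField) (F : ℝ → ℝ) (μ ν : Fin 4) (x : Pt) : ℝ :=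
  dF h Λ F x * einstein h μ ν x
    + (1 / 2) * (F (torsionScalar h Λ x) - dF h Λ F x * torsionScalar h Λ x) * metric h x μ ν
    + ∑ α, superpotLow h Λ μ ν α x * gradUp h (dF h Λ F) α x

end Teleparallel

end

noncomputable section

namespace Teleparallel

/-! ### Sums of symmetric and antisymmetric families -/

section Algebra

variable {ι A : Type*} [CommRing A] [Algebra ℝ A]

/-! The identity is algebra in a commutative ring with commuting derivations `d μ`, carrying a
metric, its torsion-free metric connection `Γ` and a flat metric connection `W`. The contortion is
`K = W - Γ`. Subtracting the two metric compatibilities makes `κ = K * gi` antisymmetric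
(`κ_transpose`). Flatness of `Γ + K` expresses the curvature of `Γ` by first derivatives and squares
of `K` (`R_eq`, `Q_eq`). Contracting once, the derivative terms of Ricci are those of minus the
divergence of the superpotential, up to a trace: `ricMix_add_mdiv_SMix` reads R_m^b + ∇_n S_m^{nb} =
K_m S^b + δ_m^b B/2, where K_m S^b stands for the sum over r, a of K^r_{am} S_r^{ab}. Contracting
twice gives R = B - T (`twoT_eq`, with B = 2 `divV`). In the divergence of E the derivatives of f
cancel by the chain rule and the Einstein tensor is divergence-free (`two_mul_mdiv_ricMix`). Ricci
contracted with ∂f_T comes from the product rule, and Ricci contracted with ∂f_B from commuting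
derivatives (`mdiv_hess`); both are cancelled by the superpotential term. The scalar terms add up to
(B - T - R) ∂f_T / 2 = 0. What remains is K_m S^b ∂_b(f_T + f_B), which equals κ_m^{ab} E_{ab}
because the symmetric part of E is invisible to κ (`sum_κ_mul_field`, `mdiv_field`). If E is
symmetric at a point, this vanishes there. For the analytic statement the ring is that of smooth
functions on U. Since W_μ = e⁻¹ ∂_μ e with e = Λ⁻¹ h, the teleparallel connection is flat; since Λ
is Lorentz, it is metric. Lemmas named `ev_…` identify each coordinate expression with the value at
a point of its algebraic counterpart. -/

theorem eq_zero_of_eq_neg {a : A} (h : a = -a) : a = 0 := by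
  have h2 : (2 : ℝ) • a = 0 := by
    rw [two_smul]; nth_rewrite 1 [h]; exact neg_add_cancel a
  exact (smul_eq_zero_iff_right (two_ne_zero' ℝ)).1 h2

theorem sum_antisymm_mul_symm [Fintype ι] {a b : ι → ι → A} (ha : ∀ i j, a i j = -a j i)
    (hb : ∀ i j, b i j = b j i) : ∑ i, ∑ j, a i j * b i j = 0 := by
  apply eq_zero_of_eq_neg
  conv_lhs => rw [Finset.sum_comm]
  rw [← Finset.sum_neg_distrib]
  refine Finset.sum_congr rfl fun i _ => ?_
  rw [← Finset.sum_neg_distrib]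
  refine Finset.sum_congr rfl fun j _ => ?_
  rw [ha j i, hb j i]; ring

/-- The entrywise derivative of a matrix. -/
def mder (D : Derivation ℝ A A) (M : Matrix ι ι A) : Matrix ι ι A := M.map D

variable (D D' : Derivation ℝ A A) (M N : Matrix ι ι A)

theorem mder_apply (i j : ι) : mder D M i j = D (M i j) := rfl

theorem mder_mul [Fintype ι] : mder D (M * N) = mder D M * N + M * mder D N := by
  ext i j
  simp only [mder_apply, Matrix.mul_apply, Matrix.add_apply, map_sum, Derivation.leibniz,
    smul_eq_mul, ← Finset.sum_add_distrib]
  exact Finset.sum_congr rfl fun k _ => by ring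

theorem mder_add : mder D (M + N) = mder D M + mder D N := by
  ext i j; simp [mder_apply]

theorem mder_sub : mder D (M - N) = mder D M - mder D N := by
  ext i j; simp [mder_apply]

theorem mder_transpose : mder D Mᵀ = (mder D M)ᵀ := rfl

theorem mder_one [DecidableEq ι] : mder D (1 : Matrix ι ι A) = 0 := by
  ext i j
  by_cases h : i = j <;> simp [mder_apply, h]

theorem mder_comm (h : ∀ a, D (D' a) = D' (D a)) : mder D (mder D' M) = mder D' (mder D M) := by
  ext i j; exact h _

theorem mder_eq_of_mul_eq_one [Fintype ι] [DecidableEq ι] {M N : Matrix ι ι A} (h : M * N = 1) :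
    mder D N = -(N * mder D M * N) := by
  have h1 : mder D M * N + M * mder D N = 0 := by rw [← mder_mul, h, mder_one]
  have h2 : N * M = 1 := mul_eq_one_comm.1 h
  calc mder D N = N * M * mder D N := by rw [h2, one_mul]
    _ = N * (mder D M * N + M * mder D N) - N * mder D M * N := by noncomm_ring
    _ = _ := by rw [h1]; simp

end Algebra

/-! ### A Levi-Civita connection together with a flat metric connection -/

/-- A metric `g` with inverse `gi`, its torsion-free metric connection `Γ` and a flat metric
connection `W`, over a ring with commuting derivations. -/
structure ConnectionPair {ι A : Type*} [Fintype ι] [DecidableEq ι] [CommRing A] [Algebra ℝ A]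
    (d : ι → Derivation ℝ A A) where
  g : Matrix ι ι A
  gi : Matrix ι ι A
  -- The label is the direction of differentiation, the row is the upper index: `Γ μ σ ν` stands for
  -- Γ°^σ_{μν}, while `W μ σ ν` stands for Γ^σ_{νμ}, whose differentiation index comes last.
  Γ : ι → Matrix ι ι A
  W : ι → Matrix ι ι A
  comm : ∀ μ ν a, d μ (d ν a) = d ν (d μ a)
  g_symm : gᵀ = g
  g_mul_gi : g * gi = 1
  Γ_symm : ∀ μ ν σ, Γ μ σ ν = Γ ν σ μ
  Γ_compat : ∀ μ, mder (d μ) g = (Γ μ)ᵀ * g + g * Γ μ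
  W_compat : ∀ μ, mder (d μ) g = (W μ)ᵀ * g + g * W μ
  W_flat : ∀ μ ν, mder (d μ) (W ν) - mder (d ν) (W μ) + (W μ * W ν - W ν * W μ) = 0

namespace ConnectionPair

variable {ι A : Type*} [Fintype ι] [DecidableEq ι] [CommRing A] [Algebra ℝ A]
  {d : ι → Derivation ℝ A A} (C : ConnectionPair d)

theorem gi_mul_g : C.gi * C.g = 1 := mul_eq_one_comm.1 C.g_mul_gi

theorem gi_symm : C.giᵀ = C.gi := by
  have h : C.giᵀ * C.g = 1 := by
    have := congrArg Matrix.transpose C.g_mul_gi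
    rwa [Matrix.transpose_mul, C.g_symm, Matrix.transpose_one] at this
  calc C.giᵀ = C.giᵀ * (C.g * C.gi) := by rw [C.g_mul_gi, mul_one]
    _ = C.gi := by rw [← mul_assoc, h, one_mul]

theorem mder_gi (μ : ι) : mder (d μ) C.gi = -(C.Γ μ * C.gi) - C.gi * (C.Γ μ)ᵀ := by
  rw [mder_eq_of_mul_eq_one (d μ) C.g_mul_gi, C.Γ_compat]
  calc -(C.gi * ((C.Γ μ)ᵀ * C.g + C.g * C.Γ μ) * C.gi)
      = -(C.gi * (C.Γ μ)ᵀ * (C.g * C.gi)) - (C.gi * C.g) * C.Γ μ * C.gi := by noncomm_ring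
    _ = _ := by rw [C.g_mul_gi, C.gi_mul_g]; noncomm_ring

/-- The contortion `K_μ`. -/
def K (μ : ι) : Matrix ι ι A := C.W μ - C.Γ μ

/-- The contortion with both matrix indices raised. -/
def κ (μ : ι) : Matrix ι ι A := C.K μ * C.gi

/-- Both connections preserve `g`, so their difference is a `g`-antisymmetric endomorphism. This is
what annihilates symmetric tensors in the final step. -/
theorem κ_transpose (μ : ι) : (C.κ μ)ᵀ = -C.κ μ := by
  have h : (C.K μ)ᵀ * C.g + C.g * C.K μ = 0 := by
    have := (C.Γ_compat μ).symm.trans (C.W_compat μ)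
    rw [K, Matrix.transpose_sub, sub_mul, mul_sub]
    rw [← sub_eq_zero] at this
    rw [← neg_eq_zero, ← this]; abel
  have h2 : C.gi * ((C.K μ)ᵀ * C.g + C.g * C.K μ) * C.gi = 0 := by rw [h]; simp
  rw [κ, Matrix.transpose_mul, C.gi_symm, eq_neg_iff_add_eq_zero, ← h2]
  calc _ = C.gi * (C.K μ)ᵀ * (C.g * C.gi) + (C.gi * C.g) * C.K μ * C.gi := by
        rw [C.g_mul_gi, C.gi_mul_g]; noncomm_ring
    _ = _ := by noncomm_ring

theorem κ_antisymm (μ a b : ι) : C.κ μ a b = -C.κ μ b a :=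
  congrFun (congrFun (C.κ_transpose μ) b) a

theorem κ_mul_g (μ : ι) : C.κ μ * C.g = C.K μ := by
  rw [κ, mul_assoc, C.gi_mul_g, mul_one]

theorem trace_K (μ : ι) : ∑ σ, C.K μ σ σ = 0 := by
  rw [← κ_mul_g]
  simp only [Matrix.mul_apply]
  exact sum_antisymm_mul_symm (C.κ_antisymm μ)
    fun i j => congrFun (congrFun C.g_symm i) j

/-! ### Curvature expressed by the contortion, and its symmetries -/

/-- The curvature of the Levi-Civita connection. -/
def R (μ ν : ι) : Matrix ι ι A :=
  mder (d μ) (C.Γ ν) - mder (d ν) (C.Γ μ) + (C.Γ μ * C.Γ ν - C.Γ ν * C.Γ μ)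

/-- The curvature with the second index raised. -/
def Q (μ ν : ι) : Matrix ι ι A := C.R μ ν * C.gi

/-- The covariant derivative of `κ_ν`, with `ν` treated as a label. -/
def P (μ ν : ι) : Matrix ι ι A :=
  mder (d μ) (C.κ ν) + C.Γ μ * C.κ ν + C.κ ν * (C.Γ μ)ᵀ

theorem R_swap (μ ν : ι) : C.R ν μ = -C.R μ ν := by simp only [R]; abel

theorem Q_swap (μ ν : ι) : C.Q ν μ = -C.Q μ ν := by rw [Q, R_swap, neg_mul, Q]

/-- Expand the vanishing curvature of `Γ + K`: the terms free of `K` are the curvature of `Γ`. -/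
theorem R_eq (μ ν : ι) : C.R μ ν =
    -((mder (d μ) (C.K ν) + C.Γ μ * C.K ν - C.K ν * C.Γ μ)
      - (mder (d ν) (C.K μ) + C.Γ ν * C.K μ - C.K μ * C.Γ ν)
      + (C.K μ * C.K ν - C.K ν * C.K μ)) := by
  have h := C.W_flat μ ν
  have hW : ∀ μ, C.W μ = C.Γ μ + C.K μ := fun μ => by rw [K]; abel
  rw [hW, hW, mder_add, mder_add] at h
  rw [R, ← sub_eq_zero, ← h]
  noncomm_ring

/-- The inverse metric is parallel, so raising an index commutes with covariant differentiation. -/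
theorem P_eq (μ ν : ι) :
    (mder (d μ) (C.K ν) + C.Γ μ * C.K ν - C.K ν * C.Γ μ) * C.gi = C.P μ ν := by
  rw [P, κ, mder_mul, mder_gi]
  noncomm_ring

theorem Q_eq (μ ν : ι) :
    C.Q μ ν = -(C.P μ ν - C.P ν μ + (C.K μ * C.κ ν - C.K ν * C.κ μ)) := by
  rw [Q, R_eq, ← P_eq, ← P_eq, κ, κ]
  noncomm_ring

theorem P_transpose (μ ν : ι) : (C.P μ ν)ᵀ = -C.P μ ν := by
  have h : (mder (d μ) (C.κ ν))ᵀ = -mder (d μ) (C.κ ν) := by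
    rw [← mder_transpose, κ_transpose]
    ext i j; simp [mder_apply]
  rw [P, Matrix.transpose_add, Matrix.transpose_add, Matrix.transpose_mul, Matrix.transpose_mul,
    Matrix.transpose_transpose, h, κ_transpose]
  noncomm_ring

theorem K_mul_κ_transpose (μ ν : ι) : (C.K μ * C.κ ν)ᵀ = C.K ν * C.κ μ := by
  rw [← κ_mul_g, ← κ_mul_g, Matrix.transpose_mul, Matrix.transpose_mul, C.g_symm, κ_transpose,
    κ_transpose]
  noncomm_ring

/-- Read off from `Q_eq`: `P` inherits antisymmetry from `κ`, and transposition exchanges the two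
quadratic terms. -/
theorem Q_transpose (μ ν : ι) : (C.Q μ ν)ᵀ = -C.Q μ ν := by
  rw [Q_eq, Matrix.transpose_neg, Matrix.transpose_add, Matrix.transpose_sub, Matrix.transpose_sub,
    K_mul_κ_transpose, K_mul_κ_transpose, P_transpose, P_transpose]
  noncomm_ring

theorem Q_antisymm (μ ν a b : ι) : C.Q μ ν a b = -C.Q μ ν b a :=
  congrFun (congrFun (C.Q_transpose μ ν) b) a

theorem Q_swap_apply (μ ν a b : ι) : C.Q μ ν a b = -C.Q ν μ a b :=
  congrFun (congrFun (C.Q_swap ν μ) a) b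

theorem Q_mul_g (μ ν : ι) : C.Q μ ν * C.g = C.R μ ν := by
  rw [Q, mul_assoc, C.gi_mul_g, mul_one]

theorem trace_R (μ ν : ι) : ∑ σ, C.R μ ν σ σ = 0 := by
  rw [← Q_mul_g]
  simp only [Matrix.mul_apply]
  exact sum_antisymm_mul_symm (C.Q_antisymm μ ν)
    fun i j => congrFun (congrFun C.g_symm i) j

theorem R_apply (μ ν ρ σ : ι) : C.R μ ν ρ σ = d μ (C.Γ ν ρ σ) - d ν (C.Γ μ ρ σ)
    + ∑ l, (C.Γ μ ρ l * C.Γ ν l σ - C.Γ ν ρ l * C.Γ μ l σ) := by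
  simp [R, mder_apply, Matrix.mul_apply, Finset.sum_sub_distrib]

theorem R_cyclic (μ ν σ ρ : ι) : C.R μ ν ρ σ + C.R ν σ ρ μ + C.R σ μ ρ ν = 0 := by
  have h : ∀ μ ν σ : ι, C.R μ ν ρ σ = (d μ (C.Γ ν ρ σ) + ∑ l, C.Γ μ ρ l * C.Γ ν l σ)
      - (d ν (C.Γ μ ρ σ) + ∑ l, C.Γ ν ρ l * C.Γ μ l σ) := fun μ ν σ => by
    rw [R_apply, Finset.sum_sub_distrib]; ring
  rw [h, h, h]
  simp only [C.Γ_symm σ ν, C.Γ_symm σ μ, C.Γ_symm ν μ]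
  ring

/-- The Ricci tensor. -/
def ric : Matrix ι ι A := Matrix.of fun m n => ∑ r, C.R r n r m

theorem ric_apply (m n : ι) : C.ric m n = ∑ r, C.R r n r m := rfl

/-- Contracting the cyclic identity shows that the antisymmetric part of Ricci is governed by the
trace of the curvature matrix, which is zero. -/
theorem ric_transpose : C.ricᵀ = C.ric := by
  ext m n
  rw [Matrix.transpose_apply, ric_apply, ric_apply, ← sub_eq_zero, ← Finset.sum_sub_distrib,
    ← neg_eq_zero, ← Finset.sum_neg_distrib, ← C.trace_R m n]
  refine Finset.sum_congr rfl fun r _ => ?_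
  have h1 := C.R_cyclic r m n r
  have h2 : C.R n r r m = -C.R r n r m := congrFun (congrFun (C.R_swap r n) r) m
  rw [h2] at h1
  linear_combination -h1

/-- The mixed Ricci tensor `R_m^n`. -/
def ricMix : Matrix ι ι A := C.ric * C.gi

theorem ricMix_apply (m n : ι) : C.ricMix m n = ∑ r, C.Q r m r n := by
  have h : C.ricMix m n = ∑ s, C.gi s n * C.ric s m := by
    rw [ricMix, Matrix.mul_apply]
    refine Finset.sum_congr rfl fun s _ => ?_
    rw [← congrFun (congrFun C.ric_transpose m) s, Matrix.transpose_apply, mul_comm]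
  simp only [h, ric_apply, Q, Matrix.mul_apply, Finset.mul_sum]
  rw [Finset.sum_comm]
  exact Finset.sum_congr rfl fun r _ => Finset.sum_congr rfl fun s _ => mul_comm _ _

/-- The Ricci scalar. -/
def scal : A := ∑ m, C.ricMix m m

/-! ### Covariant divergence and the contracted Bianchi identity -/

/-- The covariant divergence of a mixed tensor `M_m^n`. -/
def mdiv (M : Matrix ι ι A) (m : ι) : A :=
  ∑ l, (mder (d l) M - (C.Γ l)ᵀ * M + M * (C.Γ l)ᵀ) m l

theorem mdiv_eq (M : Matrix ι ι A) (m : ι) : C.mdiv M m =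
    ∑ l, d l (M m l) - ∑ l, ∑ s, C.Γ m s l * M s l + ∑ l, ∑ s, C.Γ l l s * M m s := by
  simp only [mdiv, Matrix.add_apply, Matrix.sub_apply, Finset.sum_add_distrib,
    Finset.sum_sub_distrib, mder_apply, Matrix.mul_apply, Matrix.transpose_apply]
  congr 1
  · congr 1
    exact Finset.sum_congr rfl fun l _ => Finset.sum_congr rfl fun s _ => by rw [C.Γ_symm l m]
  · exact Finset.sum_congr rfl fun l _ => Finset.sum_congr rfl fun s _ => mul_comm _ _

/-- This is the Jacobi identity for the operators ∂_μ + Γ_μ. No Christoffel terms for the labels are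
needed, and symmetry of `Γ` plays no role yet. -/
theorem R_bianchi (l μ ν : ι) :
    (mder (d l) (C.R μ ν) + C.Γ l * C.R μ ν - C.R μ ν * C.Γ l)
    + (mder (d μ) (C.R ν l) + C.Γ μ * C.R ν l - C.R ν l * C.Γ μ)
    + (mder (d ν) (C.R l μ) + C.Γ ν * C.R l μ - C.R l μ * C.Γ ν) = 0 := by
  simp only [R, mder_add, mder_sub, mder_mul]
  rw [mder_comm (d ν) (d l) _ (C.comm ν l), mder_comm (d ν) (d μ) _ (C.comm ν μ),
    mder_comm (d μ) (d l) _ (C.comm μ l)]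
  noncomm_ring

/-- The covariant derivative of the curvature, with `μ` and `ν` treated as labels. -/
def Z (l μ ν : ι) : Matrix ι ι A :=
  mder (d l) (C.Q μ ν) + C.Γ l * C.Q μ ν + C.Q μ ν * (C.Γ l)ᵀ

theorem Z_eq (l μ ν : ι) :
    (mder (d l) (C.R μ ν) + C.Γ l * C.R μ ν - C.R μ ν * C.Γ l) * C.gi = C.Z l μ ν := by
  rw [Z, Q, mder_mul, mder_gi]
  noncomm_ring

theorem Z_bianchi (l μ ν : ι) : C.Z l μ ν + C.Z μ ν l + C.Z ν l μ = 0 := by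
  rw [← Z_eq, ← Z_eq, ← Z_eq, ← add_mul, ← add_mul, R_bianchi, zero_mul]

theorem Z_apply (l μ ν a b : ι) : C.Z l μ ν a b = d l (C.Q μ ν a b)
    + ∑ s, C.Γ l a s * C.Q μ ν s b + ∑ s, C.Γ l b s * C.Q μ ν a s := by
  simp [Z, mder_apply, Matrix.mul_apply, mul_comm]

theorem Z_antisymm (l μ ν a b : ι) : C.Z l μ ν a b = C.Z l ν μ b a := by
  have h : ∀ x y, C.Q μ ν x y = C.Q ν μ y x := fun x y => by
    rw [Q_antisymm, Q_swap_apply, neg_neg]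
  simp only [Z_apply, h]
  ring

theorem two_mul_mdiv_ricMix (m : ι) : 2 * C.mdiv C.ricMix m = d m C.scal := by
  -- Double contraction of the Bianchi identity; two of its three terms agree, by antisymmetry in
  -- both index pairs.
  have h0 : ∑ μ, ∑ ν, (C.Z m μ ν μ ν + 2 * C.Z μ ν m μ ν) = 0 := by
    have h1 : ∑ μ, ∑ ν, C.Z ν m μ μ ν = ∑ μ, ∑ ν, C.Z μ ν m μ ν := by
      rw [Finset.sum_comm]
      exact Finset.sum_congr rfl fun μ _ => Finset.sum_congr rfl fun ν _ => C.Z_antisymm _ _ _ _ _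
    have h2 : ∑ μ, ∑ ν, (C.Z m μ ν + C.Z μ ν m + C.Z ν m μ) μ ν = 0 := by
      simp only [Z_bianchi, Matrix.zero_apply, Finset.sum_const_zero]
    simp only [Matrix.add_apply, Finset.sum_add_distrib, h1] at h2
    simp only [Finset.sum_add_distrib, ← Finset.mul_sum]
    linear_combination h2
  have hr : ∀ a b, ∑ ν, C.Q a ν b ν = C.ricMix a b := fun a b => by
    rw [ricMix_apply]
    exact Finset.sum_congr rfl fun r _ => by rw [Q_antisymm, Q_swap_apply, neg_neg]
  have hr' : ∀ a b, ∑ ν, C.Q ν a b ν = -C.ricMix a b := fun a b => by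
    rw [ricMix_apply, ← Finset.sum_neg_distrib]
    exact Finset.sum_congr rfl fun r _ => by rw [Q_antisymm]
  -- The extra `Γ`-sum arises because `Z` treats the labels as scalars. It supplies the connection
  -- term for the index `m` that is absent from `hB`.
  have hA : ∑ μ, ∑ ν, C.Z m μ ν μ ν = d m C.scal + 2 * ∑ l, ∑ s, C.Γ m s l * C.ricMix s l := by
    simp only [Z_apply, Finset.sum_add_distrib]
    have e1 : ∑ μ, ∑ ν, d m (C.Q μ ν μ ν) = d m C.scal := by
      simp only [← map_sum, hr, scal]
    have e2 : ∑ μ, ∑ ν, ∑ s, C.Γ m μ s * C.Q μ ν s ν = ∑ l, ∑ s, C.Γ m s l * C.ricMix s l := by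
      rw [Finset.sum_comm (f := fun l s => C.Γ m s l * C.ricMix s l)]
      refine Finset.sum_congr rfl fun μ _ => ?_
      rw [Finset.sum_comm]
      simp only [← Finset.mul_sum, hr]
    have e3 : ∑ μ, ∑ ν, ∑ s, C.Γ m ν s * C.Q μ ν μ s = ∑ l, ∑ s, C.Γ m s l * C.ricMix s l := by
      rw [Finset.sum_comm, Finset.sum_comm (f := fun l s => C.Γ m s l * C.ricMix s l)]
      refine Finset.sum_congr rfl fun ν _ => ?_
      rw [Finset.sum_comm]
      simp only [← Finset.mul_sum, ← ricMix_apply]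
    rw [e1, e2, e3]; ring
  have hB : ∑ μ, ∑ ν, C.Z μ ν m μ ν
      = -(∑ l, d l (C.ricMix m l) + ∑ l, ∑ s, C.Γ l l s * C.ricMix m s) := by
    simp only [Z_apply, Finset.sum_add_distrib]
    have e1 : ∑ μ, ∑ ν, d μ (C.Q ν m μ ν) = -∑ l, d l (C.ricMix m l) := by
      simp only [← map_sum, hr', map_neg, Finset.sum_neg_distrib]
    have e2 : ∑ μ, ∑ ν, ∑ s, C.Γ μ μ s * C.Q ν m s ν = -∑ l, ∑ s, C.Γ l l s * C.ricMix m s := by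
      rw [← Finset.sum_neg_distrib]
      refine Finset.sum_congr rfl fun μ _ => ?_
      rw [Finset.sum_comm]
      simp only [← Finset.mul_sum, hr', mul_neg, Finset.sum_neg_distrib]
    have e3 : ∑ μ, ∑ ν, ∑ s, C.Γ μ ν s * C.Q ν m μ s = 0 := by
      rw [Finset.sum_comm]
      refine Finset.sum_eq_zero fun ν _ => ?_
      simp only [mul_comm (C.Γ _ _ _)]
      exact sum_antisymm_mul_symm (C.Q_antisymm ν m) fun i j => C.Γ_symm _ _ _
    rw [e1, e2, e3]; ring
  simp only [Finset.sum_add_distrib, ← Finset.mul_sum] at h0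
  rw [hA, hB] at h0
  rw [mdiv_eq]
  linear_combination -h0

theorem mdiv_add (M N : Matrix ι ι A) (m : ι) : C.mdiv (M + N) m = C.mdiv M m + C.mdiv N m := by
  simp only [mdiv_eq, Matrix.add_apply, map_add, mul_add, Finset.sum_add_distrib]; ring

theorem mdiv_sub (M N : Matrix ι ι A) (m : ι) : C.mdiv (M - N) m = C.mdiv M m - C.mdiv N m := by
  simp only [mdiv_eq, Matrix.sub_apply, map_sub, mul_sub, Finset.sum_sub_distrib]; ring

theorem mdiv_smul (a : A) (M : Matrix ι ι A) (m : ι) :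
    C.mdiv (a • M) m = a * C.mdiv M m + ∑ l, d l a * M m l := by
  simp only [mdiv_eq, Matrix.smul_apply, smul_eq_mul, Derivation.leibniz, mul_add, mul_sub,
    Finset.mul_sum, Finset.sum_add_distrib, mul_left_comm _ a, mul_comm (d _ a)]
  ring

theorem mdiv_sum {κ : Type*} (s : Finset κ) (M : κ → Matrix ι ι A) (m : ι) :
    C.mdiv (∑ k ∈ s, M k) m = ∑ k ∈ s, C.mdiv (M k) m := by
  classical
  induction s using Finset.induction_on with
  | empty => simp [mdiv, mder]
  | insert a s ha ih => rw [Finset.sum_insert ha, Finset.sum_insert ha, mdiv_add, ih]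

theorem mdiv_one (m : ι) : C.mdiv 1 m = 0 := by
  simp [mdiv, mder_one]

/-! ### Torsion vector, superpotential and torsion scalar -/

/-- The torsion vector. -/
def v (m : ι) : A := ∑ σ, C.κ σ σ m

/-- The torsion covector. -/
def vLow (m : ι) : A := ∑ σ, C.K σ σ m

theorem vLow_eq (m : ι) : C.vLow m = ∑ a, C.v a * C.g a m := by
  simp only [vLow, v, ← κ_mul_g, Matrix.mul_apply, Finset.sum_mul]
  exact Finset.sum_comm

/-- The superpotential `S_r^{mn}`. -/
def S (r m n : ι) : A :=
  C.κ r m n - (if m = r then C.v n else 0) + (if n = r then C.v m else 0)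

theorem S_antisymm (r m n : ι) : C.S r m n = -C.S r n m := by
  rw [S, S, κ_antisymm]; ring

/-- The covariant derivative of the torsion vector. -/
def dv (m n : ι) : A := d m (C.v n) + ∑ s, C.Γ m n s * C.v s

/-- The covariant divergence of the torsion vector. -/
def divV : A := ∑ m, C.dv m m

theorem P_apply (l μ a b : ι) : C.P l μ a b = d l (C.κ μ a b)
    + ∑ s, C.Γ l a s * C.κ μ s b + ∑ s, C.Γ l b s * C.κ μ a s := by
  simp [P, mder_apply, Matrix.mul_apply, mul_comm]

theorem sum_P_fst (m b : ι) : ∑ r, C.P r m r b =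
    ∑ l, d l (C.κ m l b) + ∑ l, ∑ s, C.Γ l l s * C.κ m s b := by
  have h : ∑ r, ∑ s, C.Γ r b s * C.κ m r s = 0 := by
    simp only [mul_comm (C.Γ _ _ _)]
    exact sum_antisymm_mul_symm (C.κ_antisymm m) fun i j => C.Γ_symm _ _ _
  simp only [P_apply, Finset.sum_add_distrib, h, add_zero]

/-- The contracted index `r` is partly a label, so a `Γ`-sum survives. It is the connection term for
the index `m` that `sum_P_fst` lacks, so only the difference of the two sums is covariant. -/
theorem sum_P_snd (m b : ι) : ∑ r, C.P m r r b =
    C.dv m b + ∑ l, ∑ s, C.Γ m s l * C.κ s l b := by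
  have h : ∑ r, ∑ s, C.Γ m b s * C.κ r r s = ∑ s, C.Γ m b s * C.v s := by
    rw [Finset.sum_comm]; simp only [v, Finset.mul_sum]
  simp only [P_apply, Finset.sum_add_distrib, h, dv, v, map_sum]
  rw [Finset.sum_comm (f := fun r s => C.Γ m r s * C.κ r s b)]
  ring

/-- The superpotential `S_m^{nb}` as a mixed tensor in its first two indices. -/
def SMix (b : ι) : Matrix ι ι A := Matrix.of fun m n => C.S m n b

theorem SMix_apply (b m n : ι) : C.SMix b m n = C.S m n b := rfl

/-- Treating `b` as a label costs nothing: the omitted connection term would pair the symmetric `Γ`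
with `S`, antisymmetric in its last two indices. -/
theorem mdiv_SMix (b m : ι) : C.mdiv (C.SMix b) m =
    ∑ r, C.P r m r b - ∑ r, C.P m r r b + (if b = m then C.divV else 0) := by
  have h : C.SMix b = (Matrix.of fun m n => C.κ m n b) - C.v b • (1 : Matrix ι ι A)
      + Matrix.of fun m n => if b = m then C.v n else 0 := by
    ext m n
    simp [SMix, S, Matrix.one_apply, eq_comm]
  have h3 : C.mdiv (Matrix.of fun m n => if b = m then C.v n else 0) m =
      (if b = m then C.divV else 0) - ∑ s, C.Γ m b s * C.v s := by
    have e1 : ∑ l, ∑ s, C.Γ m s l * (if b = s then C.v l else 0) = ∑ l, C.Γ m b l * C.v l := by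
      simp
    rw [mdiv_eq]
    simp only [Matrix.of_apply, e1]
    by_cases hb : b = m
    · simp only [hb, if_true, divV, dv, Finset.sum_add_distrib]; ring
    · simp [hb]
  rw [h, mdiv_add, mdiv_sub, mdiv_smul, mdiv_one, h3, mdiv_eq, sum_P_fst, sum_P_snd, dv]
  have h4 : ∑ l, d l (C.v b) * (1 : Matrix ι ι A) m l = d m (C.v b) := by
    simp [Matrix.one_apply]
  rw [h4]
  simp only [Matrix.of_apply]
  ring

theorem ricMix_eq (m b : ι) : C.ricMix m b = -(∑ r, C.P r m r b - ∑ r, C.P m r r b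
    + (∑ a, C.vLow a * C.κ m a b - ∑ r, ∑ a, C.K m r a * C.κ r a b)) := by
  have h : ∑ r, ∑ a, C.K r r a * C.κ m a b = ∑ a, C.vLow a * C.κ m a b := by
    rw [Finset.sum_comm]; simp only [vLow, Finset.sum_mul]
  rw [ricMix_apply, ← h]
  simp only [Q_eq, Matrix.neg_apply, Matrix.add_apply, Matrix.sub_apply, Matrix.mul_apply,
    Finset.sum_add_distrib, Finset.sum_sub_distrib, Finset.sum_neg_distrib]

/-- The derivatives of the contortion in `ricMix_eq` and `mdiv_SMix` cancel. The leftover squares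
assemble into `K` contracted with `S`: one trace term of `S` meets the vanishing trace of `K`, the
other yields the torsion-vector term. -/
theorem ricMix_add_mdiv_SMix (m b : ι) : C.ricMix m b + C.mdiv (C.SMix b) m =
    ∑ r, ∑ a, C.K m r a * C.S r a b + (if b = m then C.divV else 0) := by
  have h1 : ∑ r, ∑ a, C.K m r a * (if a = r then C.v b else 0) = 0 := by
    simp [← Finset.sum_mul, trace_K]
  have h2 : ∑ r, ∑ a, C.K m r a * (if b = r then C.v a else 0)
      = -∑ a, C.vLow a * C.κ m a b := by
    rw [Finset.sum_comm]
    simp only [vLow_eq, mul_ite, mul_zero, Finset.sum_ite_eq, Finset.mem_univ, if_true]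
    simp only [← κ_mul_g, Matrix.mul_apply, Finset.sum_mul, ← Finset.sum_neg_distrib]
    rw [Finset.sum_comm]
    refine Finset.sum_congr rfl fun i _ => Finset.sum_congr rfl fun j _ => ?_
    rw [C.κ_antisymm m b, ← congrFun (congrFun C.g_symm i) j, Matrix.transpose_apply]
    ring
  have h3 : ∑ r, ∑ a, C.K m r a * C.S r a b =
      ∑ r, ∑ a, C.K m r a * C.κ r a b - ∑ a, C.vLow a * C.κ m a b := by
    simp only [S, mul_add, mul_sub, Finset.sum_add_distrib, Finset.sum_sub_distrib, h1, h2]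
    ring
  rw [ricMix_eq, mdiv_SMix, h3]
  ring

/-- Twice the torsion scalar. -/
def twoT : A := ∑ r, ∑ m, ∑ n, C.S r m n * (C.W m r n - C.W n r m)

/-- This is R = B - T, obtained as the trace of `ricMix_eq`. -/
theorem twoT_eq : C.twoT = 2 * (2 * C.divV - C.scal) := by
  have hK : ∀ r m n, C.W m r n - C.W n r m = C.K m r n - C.K n r m := fun r m n => by
    simp only [K, Matrix.sub_apply]; rw [C.Γ_symm m n r]; ring
  have h1 : C.twoT = -2 * ∑ r, ∑ m, ∑ n, C.S r m n * C.K n r m := by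
    have : ∀ r, ∑ m, ∑ n, C.S r m n * C.K m r n = -∑ m, ∑ n, C.S r m n * C.K n r m := by
      intro r
      rw [Finset.sum_comm]
      simp only [← Finset.sum_neg_distrib]
      refine Finset.sum_congr rfl fun i _ => Finset.sum_congr rfl fun j _ => ?_
      rw [S_antisymm]; ring
    simp only [twoT, hK, mul_sub, Finset.sum_sub_distrib, this, Finset.sum_neg_distrib]
    ring
  have h2 : ∑ r, ∑ m, ∑ n, C.S r m n * C.K n r m =
      ∑ n, ∑ r, ∑ m, C.K n r m * C.κ r m n + ∑ a, C.vLow a * C.v a := by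
    have e1 : ∑ r, ∑ m, ∑ n, C.κ r m n * C.K n r m
        = ∑ n, ∑ r, ∑ m, C.K n r m * C.κ r m n := by
      simp only [mul_comm (C.κ _ _ _)]
      rw [Finset.sum_comm (s := Finset.univ (α := ι)) (f := fun n r => ∑ m, C.K n r m * C.κ r m n)]
      exact Finset.sum_congr rfl fun r _ => Finset.sum_comm
    have e2 : ∑ r, ∑ m, ∑ n, (if m = r then C.v n else 0) * C.K n r m = 0 := by
      have : ∀ r, ∑ m, ∑ n, (if m = r then C.v n else 0) * C.K n r m
          = ∑ n, C.v n * C.K n r r := fun r => by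
        rw [Finset.sum_comm]; simp
      simp only [this]
      rw [Finset.sum_comm]
      simp [← Finset.mul_sum, trace_K]
    have e3 : ∑ r, ∑ m, ∑ n, (if n = r then C.v m else 0) * C.K n r m
        = ∑ a, C.vLow a * C.v a := by
      simp only [ite_mul, zero_mul, Finset.sum_ite_eq', Finset.mem_univ, if_true, vLow]
      rw [Finset.sum_comm]
      simp only [← Finset.sum_mul, mul_comm (C.v _)]
    simp only [S, add_mul, sub_mul, Finset.sum_add_distrib, Finset.sum_sub_distrib, e1, e2, e3]
    ring
  -- After the full trace the non-covariant sum of `sum_P_snd` pairs symmetric `Γ` with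
  -- antisymmetric `κ`.
  have h3 : ∑ m, ∑ r, C.P m r r m = C.divV := by
    simp only [sum_P_snd, Finset.sum_add_distrib, divV]
    rw [add_eq_left]
    have : ∀ s, ∑ m, ∑ l, C.Γ m s l * C.κ s l m = 0 := fun s => by
      rw [Finset.sum_comm]
      simp only [mul_comm (C.Γ _ _ _)]
      exact sum_antisymm_mul_symm (C.κ_antisymm s) fun i j => C.Γ_symm _ _ _
    calc _ = ∑ s, ∑ m, ∑ l, C.Γ m s l * C.κ s l m := by
          rw [Finset.sum_comm (s := Finset.univ (α := ι))
            (f := fun s m => ∑ l, C.Γ m s l * C.κ s l m)]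
          exact Finset.sum_congr rfl fun r _ => Finset.sum_comm
      _ = 0 := by simp [this]
  have h4 : ∑ m, ∑ r, C.P r m r m = -C.divV := by
    rw [← h3, ← Finset.sum_neg_distrib, Finset.sum_comm]
    refine Finset.sum_congr rfl fun i _ => ?_
    rw [← Finset.sum_neg_distrib]
    exact Finset.sum_congr rfl fun j _ => congrFun (congrFun (C.P_transpose i j) j) i
  have h5 : ∑ m, ∑ a, C.vLow a * C.κ m a m = -∑ a, C.vLow a * C.v a := by
    rw [Finset.sum_comm, ← Finset.sum_neg_distrib]
    refine Finset.sum_congr rfl fun i _ => ?_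
    rw [v, Finset.mul_sum, ← Finset.sum_neg_distrib]
    exact Finset.sum_congr rfl fun j _ => by rw [κ_antisymm]; ring
  have h6 : C.scal = 2 * C.divV + ∑ a, C.vLow a * C.v a
      + ∑ n, ∑ r, ∑ m, C.K n r m * C.κ r m n := by
    simp only [scal, ricMix_eq, Finset.sum_neg_distrib, Finset.sum_add_distrib,
      Finset.sum_sub_distrib, h3, h4, h5]
    ring
  rw [h1, h2, h6]; ring

/-! ### Derivatives of scalars -/

/-- The gradient `∂^n φ`. -/
def grad (φ : A) (n : ι) : A := ∑ s, C.gi n s * d s φ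

/-- The second covariant derivative of a scalar. -/
def hess (φ : A) : Matrix ι ι A :=
  Matrix.of fun m n => d m (d n φ) - ∑ s, C.Γ m s n * d s φ

theorem hess_transpose (φ : A) : (C.hess φ)ᵀ = C.hess φ := by
  ext m n
  simp only [hess, Matrix.transpose_apply, Matrix.of_apply, C.comm n m, C.Γ_symm n]

theorem hess_mul_gi_apply (φ : A) (m n : ι) :
    (C.hess φ * C.gi) m n = d m (C.grad φ n) + ∑ s, C.Γ m n s * C.grad φ s := by
  have h : ∀ s, d m (C.gi n s) = -(∑ t, C.Γ m n t * C.gi t s) - ∑ t, C.gi n t * C.Γ m s t :=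
    fun s => by
      have := congrFun (congrFun (C.mder_gi m) n) s
      simpa [mder_apply, Matrix.mul_apply] using this
  have e1 : ∑ s, ∑ t, d s φ * (C.Γ m n t * C.gi t s)
      = ∑ s, ∑ t, C.Γ m n s * (C.gi s t * d t φ) := by
    rw [Finset.sum_comm]
    exact Finset.sum_congr rfl fun i _ => Finset.sum_congr rfl fun j _ => by ring
  have e2 : ∑ s, ∑ t, d s φ * (C.gi n t * C.Γ m s t)
      = ∑ t, ∑ s, C.Γ m s t * d s φ * C.gi t n := by
    rw [Finset.sum_comm]
    refine Finset.sum_congr rfl fun i _ => Finset.sum_congr rfl fun j _ => ?_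
    rw [← congrFun (congrFun C.gi_symm n) i, Matrix.transpose_apply]; ring
  have e3 : ∑ s, C.gi n s * d m (d s φ) = ∑ s, d m (d s φ) * C.gi s n := by
    refine Finset.sum_congr rfl fun i _ => ?_
    rw [← congrFun (congrFun C.gi_symm n) i, Matrix.transpose_apply, mul_comm]
  simp only [Matrix.mul_apply, hess, Matrix.of_apply, grad, map_sum, Derivation.leibniz,
    smul_eq_mul, h, mul_sub, sub_mul, mul_neg, Finset.mul_sum, Finset.sum_mul,
    Finset.sum_add_distrib, Finset.sum_sub_distrib, Finset.sum_neg_distrib, e1, e2, e3]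
  ring

/-- The d'Alembertian. -/
def box (φ : A) : A := ∑ m, (C.hess φ * C.gi) m m

/-- With u the gradient of φ, the left side is ∇_l ∇_m u^l; commuting the two derivatives produces
the Ricci term. -/
theorem mdiv_hess (φ : A) (m : ι) :
    C.mdiv (C.hess φ * C.gi) m = d m (C.box φ) + ∑ s, C.ric s m * C.grad φ s := by
  set u := C.grad φ with hu
  have hR : ∑ s, C.ric s m * u s = ∑ l, ∑ s, d l (C.Γ m l s) * u s
      - ∑ l, ∑ s, d m (C.Γ l l s) * u s + ∑ l, ∑ s, ∑ t, C.Γ l l t * (C.Γ m t s * u s)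
      - ∑ l, ∑ s, ∑ t, C.Γ m l t * (C.Γ l t s * u s) := by
    simp only [ric_apply, R_apply, Finset.sum_mul]
    rw [Finset.sum_comm]
    simp only [add_mul, sub_mul, Finset.sum_mul, Finset.sum_add_distrib,
      Finset.sum_sub_distrib, mul_assoc]
    ring
  have e1 : ∑ l, ∑ s, C.Γ m s l * d s (u l) = ∑ l, ∑ s, C.Γ m l s * d l (u s) := Finset.sum_comm
  have e2 : ∑ l, ∑ s, ∑ t, C.Γ m s l * (C.Γ s l t * u t)
      = ∑ l, ∑ s, ∑ t, C.Γ m l t * (C.Γ l t s * u s) := by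
    rw [Finset.sum_comm]
    exact Finset.sum_congr rfl fun i _ => Finset.sum_comm
  have e3 : ∑ l, ∑ s, ∑ t, C.Γ l l s * (C.Γ m s t * u t)
      = ∑ l, ∑ s, ∑ t, C.Γ l l t * (C.Γ m t s * u s) :=
    Finset.sum_congr rfl fun i _ => Finset.sum_comm
  have e4 : ∑ l, d l (d m (u l)) = ∑ l, d m (d l (u l)) :=
    Finset.sum_congr rfl fun i _ => C.comm _ _ _
  have e5 : ∀ a b : ι → ι → A, ∑ l, ∑ s, (a l s * b l s) = ∑ l, ∑ s, b l s * a l s := fun a b =>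
    Finset.sum_congr rfl fun i _ => Finset.sum_congr rfl fun j _ => mul_comm _ _
  rw [hR, mdiv_eq, box]
  simp only [hess_mul_gi_apply, ← hu, map_add, map_sum, Derivation.leibniz, smul_eq_mul, mul_add,
    Finset.mul_sum, Finset.sum_add_distrib, e1, e2, e3, e4]
  rw [e5 (fun l s => d l (C.Γ m l s)), e5 (fun l s => d m (C.Γ l l s))]
  ring

/-- The contraction `S_m^{nb} ∂_b φ`. -/
def SGrad (φ : A) : Matrix ι ι A := ∑ b, d b φ • C.SMix b

theorem SGrad_apply (φ : A) (m n : ι) : C.SGrad φ m n = ∑ b, d b φ * C.S m n b := by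
  simp [SGrad, Matrix.sum_apply, SMix]

/-- Second derivatives of `φ` drop out, since they are symmetric and `S` is antisymmetric in its
last two indices. -/
theorem mdiv_SGrad (φ : A) (m : ι) :
    C.mdiv (C.SGrad φ) m = ∑ b, d b φ * C.mdiv (C.SMix b) m := by
  have h : ∑ b, ∑ l, d l (d b φ) * C.SMix b m l = 0 := by
    simp only [mul_comm (d _ (d _ φ)), SMix_apply]
    exact sum_antisymm_mul_symm (fun i j => C.S_antisymm m j i) fun i j => C.comm _ _ _
  simp only [SGrad, mdiv_sum, mdiv_smul, Finset.sum_add_distrib, h, add_zero]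

/-! ### Field equations and the generalized Bianchi identity -/

/-- The symmetric part of the field equations of `f(T,B)` gravity. -/
def fieldSymm (f fT fB : A) : Matrix ι ι A :=
  fT • (C.ric - (algebraMap ℝ A (1 / 2) * C.scal) • C.g)
    + (algebraMap ℝ A (1 / 2) * (f - fT * (algebraMap ℝ A (1 / 2) * C.twoT)
      - fB * (2 * C.divV))) • C.g
    - (C.box fB • C.g - C.hess fB)

/-- The left-hand side of the field equations of `f(T,B)` gravity. -/
def field (f fT fB : A) : Matrix ι ι A := C.fieldSymm f fT fB + C.SGrad (fT + fB) * C.g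

theorem fieldSymm_transpose (f fT fB : A) : (C.fieldSymm f fT fB)ᵀ = C.fieldSymm f fT fB := by
  simp only [fieldSymm, Matrix.transpose_sub, Matrix.transpose_add, Matrix.transpose_smul,
    C.g_symm, C.ric_transpose, C.hess_transpose]

theorem sum_κ_mul_field (f fT fB : A) (m : ι) :
    ∑ a, ∑ b, C.κ m a b * C.field f fT fB a b =
      ∑ b, d b (fT + fB) * ∑ r, ∑ a, C.K m r a * C.S r a b := by
  have h1 : ∑ a, ∑ b, C.κ m a b * C.fieldSymm f fT fB a b = 0 :=
    sum_antisymm_mul_symm (C.κ_antisymm m)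
      fun i j => congrFun (congrFun (C.fieldSymm_transpose f fT fB) j) i
  have h2 : ∑ a, ∑ b, C.κ m a b * (C.SGrad (fT + fB) * C.g) a b
      = ∑ r, ∑ a, C.K m r a * C.SGrad (fT + fB) r a := by
    refine Finset.sum_congr rfl fun r _ => ?_
    simp only [← κ_mul_g, Matrix.mul_apply, Finset.mul_sum, Finset.sum_mul]
    rw [Finset.sum_comm]
    refine Finset.sum_congr rfl fun i _ => Finset.sum_congr rfl fun j _ => ?_
    rw [← congrFun (congrFun C.g_symm i) j, Matrix.transpose_apply]; ring
  have h3 : ∑ a, ∑ b, C.κ m a b * C.field f fT fB a b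
      = ∑ r, ∑ a, C.K m r a * C.SGrad (fT + fB) r a := by
    rw [← h2, ← zero_add (∑ a, ∑ b, C.κ m a b * (C.SGrad (fT + fB) * C.g) a b), ← h1]
    simp only [field, Matrix.add_apply, mul_add, Finset.sum_add_distrib]
  simp only [h3, SGrad_apply, Finset.mul_sum]
  rw [Finset.sum_comm (s := Finset.univ (α := ι))
    (f := fun b r => ∑ a, d b (fT + fB) * (C.K m r a * C.S r a b))]
  refine Finset.sum_congr rfl fun r _ => ?_
  rw [Finset.sum_comm]
  exact Finset.sum_congr rfl fun i _ => Finset.sum_congr rfl fun j _ => mul_left_comm _ _ _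

theorem two_mul_half : (2 : A) * algebraMap ℝ A (1 / 2) = 1 := by
  rw [← map_ofNat (algebraMap ℝ A) 2, ← map_mul]; norm_num

theorem mdiv_field (f fT fB : A) (m : ι)
    (hf : d m f = fT * d m (algebraMap ℝ A (1 / 2) * C.twoT) + fB * d m (2 * C.divV)) :
    C.mdiv (C.field f fT fB * C.gi) m = ∑ a, ∑ b, C.κ m a b * C.field f fT fB a b := by
  set half := algebraMap ℝ A (1 / 2) with hhalf
  have h2 : 2 * half = 1 := two_mul_half
  have hd : d m half = 0 := Derivation.map_algebraMap _ _
  set ψ := half * (f - fT * (half * C.twoT) - fB * (2 * C.divV)) with hψ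
  have hE : C.field f fT fB * C.gi = fT • (C.ricMix - (half * C.scal) • (1 : Matrix ι ι A))
      + ψ • (1 : Matrix ι ι A) - (C.box fB • (1 : Matrix ι ι A) - C.hess fB * C.gi)
      + C.SGrad (fT + fB) := by
    simp only [field, fieldSymm, add_mul, sub_mul, smul_mul_assoc, mul_assoc, C.g_mul_gi, mul_one,
      ← hhalf, ricMix]
    rfl
  have hone : ∀ a : A, ∑ l, d l a * (1 : Matrix ι ι A) m l = d m a := fun a => by
    simp [Matrix.one_apply]
  have hric : ∑ s, C.ric s m * C.grad fB s = ∑ l, d l fB * C.ricMix m l := by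
    simp only [ricMix, Matrix.mul_apply, grad, Finset.mul_sum]
    rw [Finset.sum_comm]
    refine Finset.sum_congr rfl fun i _ => Finset.sum_congr rfl fun j _ => ?_
    rw [← congrFun (congrFun C.ric_transpose m) j, Matrix.transpose_apply]; ring
  -- The chain rule `hf` removes the derivatives of T and B, as for a Legendre transform.
  have hψd : d m ψ = -half * (half * C.twoT * d m fT + 2 * C.divV * d m fB) := by
    rw [hψ, Derivation.leibniz, hd, map_sub, map_sub, hf, Derivation.leibniz (d m) fT,
      Derivation.leibniz (d m) fB]
    simp only [smul_eq_mul]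
    ring
  have hscal : half * C.twoT = 2 * C.divV - C.scal := by
    rw [twoT_eq]; linear_combination (2 * C.divV - C.scal) * h2
  have hG : ∑ l, d l fT * (C.ricMix - (half * C.scal) • (1 : Matrix ι ι A)) m l
      = ∑ l, d l fT * C.ricMix m l - half * C.scal * d m fT := by
    simp only [Matrix.sub_apply, mul_sub, Finset.sum_sub_distrib, Matrix.smul_apply, smul_eq_mul,
      mul_left_comm _ (half * C.scal), ← Finset.mul_sum, hone]
  -- Here the superpotential term produces the negative Ricci contractions that cancel those of `hG`
  -- and `hric`.
  have hS : ∑ b, d b (fT + fB) * C.mdiv (C.SMix b) m =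
      ∑ b, d b (fT + fB) * ∑ r, ∑ a, C.K m r a * C.S r a b + d m (fT + fB) * C.divV
        - (∑ l, d l fT * C.ricMix m l + ∑ l, d l fB * C.ricMix m l) := by
    have h : ∀ b, C.mdiv (C.SMix b) m = ∑ r, ∑ a, C.K m r a * C.S r a b
        + (if b = m then C.divV else 0) - C.ricMix m b := fun b => by
      rw [← ricMix_add_mdiv_SMix]; ring
    have h' : ∑ b, d b (fT + fB) * (if b = m then C.divV else 0) = d m (fT + fB) * C.divV := by
      simp
    simp only [h, mul_add, mul_sub, Finset.sum_add_distrib, Finset.sum_sub_distrib, h']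
    simp only [map_add, add_mul, Finset.sum_add_distrib]
  rw [sum_κ_mul_field, hE, mdiv_add, mdiv_sub, mdiv_sub, mdiv_add, mdiv_smul, mdiv_smul, mdiv_smul,
    mdiv_one, mdiv_sub, mdiv_smul, mdiv_one, hone, hone, hone, mdiv_hess, hric, mdiv_SGrad, hS, hG,
    hψd, hscal, Derivation.leibniz, hd, map_add, ← two_mul_mdiv_ricMix]
  simp only [smul_eq_mul]
  linear_combination (-fT * C.mdiv C.ricMix m) * h2
    - (C.divV * d m fT + C.divV * d m fB) * h2

end ConnectionPair

/-! ### Jacobi's formula -/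

section Algebra

variable {ι A : Type*} [Fintype ι] [DecidableEq ι] [CommRing A] [Algebra ℝ A]

/-- Jacobi's formula for a derivation. -/
theorem derivation_det (D : Derivation ℝ A A) {M N : Matrix ι ι A} (h : M * N = 1) :
    D M.det = M.det * (N * mder D M).trace := by
  -- The Leibniz rule says exactly that a ↦ a + ε D a is a ring homomorphism, and ring homomorphisms
  -- commute with determinants.
  let φ : A →+* DualNumber A :=
    { toFun := fun a => TrivSqZeroExt.inl a + TrivSqZeroExt.inr (D a)
      map_one' := by ext <;> simp
      map_mul' := fun a b => by ext <;> simp [mul_comm]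
      map_zero' := by ext <;> simp
      map_add' := fun a b => by ext <;> simp }
  let i : A →+* DualNumber A := TrivSqZeroExt.inlHom A A
  have hφ : ∀ a, φ a = i a + DualNumber.eps * i (D a) := fun a => by
    ext <;> simp [φ, i]
  have h1 : M.map φ = i.mapMatrix M * (1 + DualNumber.eps (R := A) • i.mapMatrix (N * mder D M)) := by
    have h2 : i.mapMatrix M * i.mapMatrix (N * mder D M) = i.mapMatrix (mder D M) := by
      rw [← map_mul, ← mul_assoc, h, one_mul]
    rw [mul_add, mul_one, mul_smul_comm, h2]
    ext1 a b
    simp [hφ, mder_apply]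
  have h3 : φ M.det = i M.det * (1 + (i.mapMatrix (N * mder D M)).trace * DualNumber.eps) := by
    have h4 : (DualNumber.eps : DualNumber A) ^ 2 = 0 := by rw [sq, DualNumber.eps_mul_eps]
    -- In det(1 + εX) only the trace term survives, because ε² = 0.
    rw [RingHom.map_det, RingHom.mapMatrix_apply, h1, Matrix.det_mul, Matrix.det_one_add_smul, h4,
      mul_zero, add_zero, ← RingHom.map_det]
  have h5 : (i.mapMatrix (N * mder D M)).trace = i (N * mder D M).trace := by
    simp only [Matrix.trace, map_sum]
    rfl
  rw [h5] at h3
  have := congrArg TrivSqZeroExt.snd h3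
  simpa [φ, i] using this

end Algebra

/-! ### Index forms that match the coordinate definitions -/

namespace ConnectionPair

variable {ι A : Type*} [Fintype ι] [DecidableEq ι] [CommRing A] [Algebra ℝ A]
  {d : ι → Derivation ℝ A A} (C : ConnectionPair d)

theorem g_apply_symm (i j : ι) : C.g i j = C.g j i := congrFun (congrFun C.g_symm j) i

theorem gi_apply_symm (i j : ι) : C.gi i j = C.gi j i := congrFun (congrFun C.gi_symm j) i

theorem sum_gi_mul_covD (E : Matrix ι ι A) (m : ι) :
    ∑ n, ∑ l, C.gi n l * (d l (E m n) - ∑ s, C.Γ l s m * E s n - ∑ s, C.Γ l s n * E m s)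
      = C.mdiv (E * C.gi) m := by
  have h : ∀ l, mder (d l) (E * C.gi) - (C.Γ l)ᵀ * (E * C.gi) + E * C.gi * (C.Γ l)ᵀ
      = (mder (d l) E - (C.Γ l)ᵀ * E - E * C.Γ l) * C.gi := fun l => by
    rw [mder_mul, mder_gi]; noncomm_ring
  simp only [mdiv, h]
  rw [Finset.sum_comm]
  refine Finset.sum_congr rfl fun l _ => ?_
  rw [Matrix.mul_apply]
  refine Finset.sum_congr rfl fun n _ => ?_
  simp only [Matrix.sub_apply, mder_apply, Matrix.mul_apply, Matrix.transpose_apply,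
    mul_comm (E m _)]
  ring

theorem scal_eq : C.scal = ∑ m, ∑ n, C.gi m n * C.ric m n := by
  simp only [scal, ricMix, Matrix.mul_apply]
  refine Finset.sum_congr rfl fun m _ => Finset.sum_congr rfl fun n _ => ?_
  rw [C.gi_apply_symm m n, mul_comm]

theorem box_eq (φ : A) : C.box φ = ∑ m, ∑ n, C.gi m n * C.hess φ m n := by
  simp only [box, Matrix.mul_apply]
  refine Finset.sum_congr rfl fun m _ => Finset.sum_congr rfl fun n _ => ?_
  rw [C.gi_apply_symm m n, mul_comm]

theorem sum_gi_mul_vLow (m : ι) : ∑ n, C.gi m n * C.vLow n = C.v m := by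
  have h : C.g * C.gi = 1 := C.g_mul_gi
  calc ∑ n, C.gi m n * C.vLow n = ∑ a, C.v a * (C.g * C.gi) a m := by
        simp only [vLow_eq, Finset.mul_sum, Matrix.mul_apply]
        rw [Finset.sum_comm]
        refine Finset.sum_congr rfl fun i _ => Finset.sum_congr rfl fun j _ => ?_
        rw [C.gi_apply_symm m j]; ring
    _ = C.v m := by rw [h]; simp [Matrix.one_apply]

theorem sum_torsion_eq_vLow (n : ι) : ∑ s, (C.W s s n - C.W n s s) = C.vLow n := by
  have h : ∀ s, C.W s s n - C.W n s s = C.K s s n - C.K n s s := fun s => by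
    simp only [K, Matrix.sub_apply]; rw [C.Γ_symm s n s]; ring
  simp only [h, Finset.sum_sub_distrib, trace_K, sub_zero, vLow]

theorem κ_apply (r m n : ι) : C.κ r m n = ∑ s, C.gi n s * (C.W r m s - C.Γ s m r) := by
  simp only [κ, K, Matrix.mul_apply, Matrix.sub_apply]
  refine Finset.sum_congr rfl fun s _ => ?_
  rw [C.gi_apply_symm n s, C.Γ_symm s r m, mul_comm]

theorem SGrad_mul_g_apply (φ : A) (m n : ι) : (C.SGrad φ * C.g) m n =
    ∑ a, (∑ s, ∑ b, C.g n s * C.g a b * C.S m s b) * C.grad φ a := by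
  have h : ∀ b, ∑ a, C.g a b * C.grad φ a = d b φ := fun b => by
    calc ∑ a, C.g a b * C.grad φ a = ∑ t, (C.g * C.gi) b t * d t φ := by
          simp only [grad, Finset.mul_sum, Matrix.mul_apply, Finset.sum_mul]
          rw [Finset.sum_comm]
          refine Finset.sum_congr rfl fun i _ => Finset.sum_congr rfl fun j _ => ?_
          rw [C.g_apply_symm j b]; ring
      _ = d b φ := by rw [C.g_mul_gi]; simp [Matrix.one_apply]
  simp only [Matrix.mul_apply, SGrad_apply, ← h, Finset.sum_mul]
  rw [Finset.sum_comm (s := Finset.univ (α := ι)) (t := Finset.univ (α := ι))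
    (f := fun a s => ∑ b, C.g n s * C.g a b * C.S m s b * C.grad φ a)]
  refine Finset.sum_congr rfl fun s _ => ?_
  rw [Finset.sum_comm]
  refine Finset.sum_congr rfl fun i _ => Finset.sum_congr rfl fun j _ => ?_
  rw [C.g_apply_symm n s]; ring

theorem trace_Γ (m : ι) : ∑ s, C.Γ m s s = ∑ s, C.W m s s := by
  have := C.trace_K m
  simp only [K, Matrix.sub_apply, Finset.sum_sub_distrib] at this
  linear_combination -this

/-- Applied with `D` the tetrad determinant, this identifies B with 2 `divV`. `K` is traceless, so
`W` and `Γ` have equal traces and the density derivative is the covariant divergence. -/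
theorem sum_deriv_mul_v (D : A) (hD : ∀ m, d m D = D * ∑ s, C.W m s s) :
    ∑ m, d m (D * C.v m) = D * C.divV := by
  have h : ∑ m, ∑ s, C.Γ m m s * C.v s = ∑ s, (∑ m, C.W s m m) * C.v s := by
    rw [Finset.sum_comm]
    refine Finset.sum_congr rfl fun i _ => ?_
    rw [← trace_Γ, Finset.sum_mul]
    exact Finset.sum_congr rfl fun j _ => by rw [C.Γ_symm]
  simp only [divV, dv, Finset.sum_add_distrib, h, mul_add, Finset.mul_sum, Derivation.leibniz,
    smul_eq_mul, hD]
  congr 1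
  refine Finset.sum_congr rfl fun i _ => ?_
  rw [← Finset.mul_sum, ← Finset.mul_sum]
  ring

end ConnectionPair

/-! ### The connections of a tetrad and a Lorentz matrix field -/

/-- A tetrad `h` and a matrix field `L` preserving the constant form `η`, with their inverses. -/
structure TetradPair {ι A : Type*} [Fintype ι] [DecidableEq ι] [CommRing A] [Algebra ℝ A]
    (d : ι → Derivation ℝ A A) where
  η : Matrix ι ι A
  h : Matrix ι ι A
  hi : Matrix ι ι A
  L : Matrix ι ι A
  Li : Matrix ι ι A
  comm : ∀ μ ν a, d μ (d ν a) = d ν (d μ a)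
  η_symm : ηᵀ = η
  η_sq : η * η = 1
  η_const : ∀ μ, mder (d μ) η = 0
  h_mul_hi : h * hi = 1
  L_mul_Li : L * Li = 1
  -- Stated for `Li`, the form needed for `e = Li * h` to have the same metric as `h`.
  lorentz : Liᵀ * η * Li = η

namespace TetradPair

variable {ι A : Type*} [Fintype ι] [DecidableEq ι] [CommRing A] [Algebra ℝ A]
  {d : ι → Derivation ℝ A A} (t : TetradPair d)

/-- The metric. -/
def g : Matrix ι ι A := t.hᵀ * t.η * t.h

/-- The inverse metric. -/
def gi : Matrix ι ι A := t.hi * t.η * t.hiᵀ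

/-- The Christoffel symbols. -/
def Γ (μ : ι) : Matrix ι ι A := Matrix.of fun σ ν => ∑ ρ, algebraMap ℝ A (1 / 2) * t.gi σ ρ *
  (d μ (t.g ρ ν) + d ν (t.g ρ μ) - d ρ (t.g μ ν))

/-- The teleparallel connection. -/
def W (μ : ι) : Matrix ι ι A := t.hi * (mder (d μ) t.h + t.L * mder (d μ) t.Li * t.h)

/-- The tetrad in the gauge with vanishing spin connection. -/
def e : Matrix ι ι A := t.Li * t.h

/-- The inverse of `e`. -/
def ei : Matrix ι ι A := t.hi * t.L

theorem hi_mul_h : t.hi * t.h = 1 := mul_eq_one_comm.1 t.h_mul_hi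

theorem Li_mul_L : t.Li * t.L = 1 := mul_eq_one_comm.1 t.L_mul_Li

theorem e_mul_ei : t.e * t.ei = 1 := by
  calc t.Li * t.h * (t.hi * t.L) = t.Li * (t.h * t.hi) * t.L := by noncomm_ring
    _ = 1 := by rw [t.h_mul_hi, mul_one, t.Li_mul_L]

theorem W_eq (μ : ι) : t.W μ = t.ei * mder (d μ) t.e := by
  rw [W, ei, e, mder_mul]
  calc _ = t.hi * (t.L * t.Li) * mder (d μ) t.h + t.hi * t.L * mder (d μ) t.Li * t.h := by
        rw [t.L_mul_Li]; noncomm_ring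
    _ = _ := by noncomm_ring

theorem e_mul_W (μ : ι) : t.e * t.W μ = mder (d μ) t.e := by
  rw [W_eq, ← mul_assoc, e_mul_ei, one_mul]

theorem g_eq : t.g = t.eᵀ * t.η * t.e := by
  rw [g, e, Matrix.transpose_mul]
  conv_lhs => rw [← t.lorentz]
  noncomm_ring

theorem g_symm : t.gᵀ = t.g := by
  simp only [g, Matrix.transpose_mul, Matrix.transpose_transpose, t.η_symm, mul_assoc]

theorem g_mul_gi : t.g * t.gi = 1 := by
  have h1 : t.hᵀ * t.hiᵀ = 1 := by
    rw [← Matrix.transpose_mul, t.hi_mul_h, Matrix.transpose_one]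
  calc t.hᵀ * t.η * t.h * (t.hi * t.η * t.hiᵀ)
      = t.hᵀ * t.η * (t.h * t.hi) * t.η * t.hiᵀ := by noncomm_ring
    _ = t.hᵀ * (t.η * t.η) * t.hiᵀ := by rw [t.h_mul_hi]; noncomm_ring
    _ = 1 := by rw [t.η_sq, mul_one, h1]

theorem g_mul_Γ_apply (μ ρ ν : ι) : (t.g * t.Γ μ) ρ ν =
    algebraMap ℝ A (1 / 2) * (d μ (t.g ρ ν) + d ν (t.g ρ μ) - d ρ (t.g μ ν)) := by
  calc (t.g * t.Γ μ) ρ ν = ∑ s, (t.g * t.gi) ρ s *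
        (algebraMap ℝ A (1 / 2) * (d μ (t.g s ν) + d ν (t.g s μ) - d s (t.g μ ν))) := by
        simp only [Matrix.mul_apply, Γ, Matrix.of_apply, Finset.mul_sum, Finset.sum_mul]
        rw [Finset.sum_comm]
        exact Finset.sum_congr rfl fun i _ => Finset.sum_congr rfl fun j _ => by ring
    _ = _ := by rw [t.g_mul_gi]; simp [Matrix.one_apply]

theorem Γ_compat (μ : ι) : mder (d μ) t.g = (t.Γ μ)ᵀ * t.g + t.g * t.Γ μ := by
  have h : (t.Γ μ)ᵀ * t.g = (t.g * t.Γ μ)ᵀ := by rw [Matrix.transpose_mul, t.g_symm]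
  have hg : ∀ i j, t.g i j = t.g j i := fun i j => congrFun (congrFun t.g_symm j) i
  ext i j
  rw [h, Matrix.add_apply, Matrix.transpose_apply, g_mul_Γ_apply, g_mul_Γ_apply, mder_apply,
    hg j i, hg j μ, hg i μ]
  have h2 : (2 : A) * algebraMap ℝ A (1 / 2) = 1 := ConnectionPair.two_mul_half
  linear_combination -(d μ (t.g i j)) * h2

theorem W_compat (μ : ι) : mder (d μ) t.g = (t.W μ)ᵀ * t.g + t.g * t.W μ := by
  rw [g_eq, mder_mul, mder_mul, mder_transpose, ← e_mul_W, t.η_const, Matrix.transpose_mul]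
  noncomm_ring

/-- `W` is the pure-gauge connection e⁻¹ ∂e, so flatness reduces to commuting second derivatives of
`e`. -/
theorem W_flat (μ ν : ι) : mder (d μ) (t.W ν) - mder (d ν) (t.W μ)
    + (t.W μ * t.W ν - t.W ν * t.W μ) = 0 := by
  have h : ∀ μ ν, mder (d μ) (t.W ν) = -(t.W μ * t.W ν) + t.ei * mder (d μ) (mder (d ν) t.e) :=
    fun μ ν => by
      rw [W_eq, W_eq, mder_mul, mder_eq_of_mul_eq_one (d μ) t.e_mul_ei]; noncomm_ring
  rw [h, h, mder_comm (d μ) (d ν) t.e (t.comm μ ν)]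
  noncomm_ring

/-- The pair of connections of a tetrad. -/
def toConnectionPair : ConnectionPair d where
  g := t.g
  gi := t.gi
  Γ := t.Γ
  W := t.W
  comm := t.comm
  g_symm := t.g_symm
  g_mul_gi := t.g_mul_gi
  Γ_symm μ ν σ := Finset.sum_congr rfl fun ρ _ => by
    rw [← congrFun (congrFun t.g_symm ν) μ, Matrix.transpose_apply]; ring
  Γ_compat := t.Γ_compat
  W_compat := t.W_compat
  W_flat := t.W_flat

/-- Differentiating the Lorentz condition puts ∂(Λ⁻¹)Λ in the Lorentz Lie algebra. Its transpose is
minus a conjugate of itself, so its trace is its own negative. -/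
theorem trace_spin (μ : ι) : (t.L * mder (d μ) t.Li).trace = 0 := by
  set X := mder (d μ) t.Li with hX
  have h1 : Xᵀ * t.η * t.Li + t.Liᵀ * t.η * X = 0 := by
    have := congrArg (mder (d μ)) t.lorentz
    rw [mder_mul, mder_mul, mder_transpose, t.η_const] at this
    rw [← this]; noncomm_ring
  have hL : t.Lᵀ * t.Liᵀ = 1 := by
    rw [← Matrix.transpose_mul, t.Li_mul_L, Matrix.transpose_one]
  have h2 : (X * t.L)ᵀ * t.η + t.η * (X * t.L) = 0 := by
    calc _ = t.Lᵀ * Xᵀ * t.η * (t.Li * t.L) + (t.Lᵀ * t.Liᵀ) * t.η * (X * t.L) := by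
          rw [t.Li_mul_L, hL, Matrix.transpose_mul]; noncomm_ring
      _ = t.Lᵀ * (Xᵀ * t.η * t.Li + t.Liᵀ * t.η * X) * t.L := by noncomm_ring
      _ = 0 := by rw [h1]; simp
  have h3 : (X * t.L)ᵀ = -(t.η * (X * t.L) * t.η) := by
    calc (X * t.L)ᵀ = ((X * t.L)ᵀ * t.η + t.η * (X * t.L)) * t.η - t.η * (X * t.L) * t.η := by
          rw [add_mul, mul_assoc, t.η_sq]; noncomm_ring
      _ = _ := by rw [h2]; noncomm_ring
  rw [Matrix.trace_mul_comm]
  apply eq_zero_of_eq_neg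
  calc (X * t.L).trace = ((X * t.L)ᵀ).trace := (Matrix.trace_transpose _).symm
    _ = -(X * t.L).trace := by
      rw [h3, Matrix.trace_neg, Matrix.trace_mul_comm, ← mul_assoc, t.η_sq, one_mul]

theorem deriv_det (μ : ι) : d μ t.h.det = t.h.det * ∑ s, t.W μ s s := by
  have h : (t.hi * mder (d μ) t.h).trace = (t.W μ).trace := by
    rw [W, mul_add, Matrix.trace_add, ← mul_assoc t.hi, Matrix.trace_mul_comm (t.hi * _),
      ← mul_assoc, t.h_mul_hi, one_mul, t.trace_spin, add_zero]
  rw [derivation_det (d μ) t.h_mul_hi, h, Matrix.trace]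
  rfl

end TetradPair

/-! ### The ring of smooth functions on an open set -/

theorem pd_congr {U : Set Pt} (hU : IsOpen U) {φ ψ : Pt → ℝ} (h : ∀ x ∈ U, φ x = ψ x) (μ : Fin 4)
    {x : Pt} (hx : x ∈ U) : pd μ φ x = pd μ ψ x := by
  have : φ =ᶠ[nhds x] ψ := Filter.eventually_of_mem (hU.mem_nhds hx) h
  rw [pd, pd, this.fderiv_eq]

theorem contDiffOn_pd {U : Set Pt} (hU : IsOpen U) {φ : Pt → ℝ} (h : ContDiffOn ℝ ∞ φ U)
    (μ : Fin 4) : ContDiffOn ℝ ∞ (pd μ φ) U :=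
  (h.fderiv_of_isOpen hU (by simp)).clm_apply contDiffOn_const

theorem pd_comm {U : Set Pt} (hU : IsOpen U) {φ : Pt → ℝ} (h : ContDiffOn ℝ ∞ φ U)
    (μ ν : Fin 4) {x : Pt} (hx : x ∈ U) : pd μ (pd ν φ) x = pd ν (pd μ φ) x := by
  have h1 : DifferentiableAt ℝ (fderiv ℝ φ) x :=
    ((h.fderiv_of_isOpen hU (m := ∞) (by simp)).contDiffAt (hU.mem_nhds hx)).differentiableAt
      (by simp)
  have h2 : ∀ μ ν, pd μ (pd ν φ) x
      = fderiv ℝ (fderiv ℝ φ) x (Pi.single μ 1) (Pi.single ν 1) := fun μ ν => by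
    have : pd ν φ = fun y => fderiv ℝ φ y (Pi.single ν 1) := rfl
    rw [this, pd, fderiv_clm_apply h1 (differentiableAt_const _)]
    simp
  rw [h2, h2]
  exact ((h.contDiffAt (hU.mem_nhds hx)).isSymmSndFDerivAt
    (by simpa using WithTop.coe_le_coe.2 (le_top : (2 : ℕ∞) ≤ ⊤))).eq _ _

/-- The ring of smooth real functions on an open set. -/
def smoothRing (U : TopologicalSpace.Opens Pt) : Subalgebra ℝ (U → ℝ) where
  carrier := {f | ∃ F : Pt → ℝ, ContDiffOn ℝ ∞ F U ∧ ∀ x : U, F x = f x}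
  mul_mem' := fun ⟨F, hF, hF'⟩ ⟨G, hG, hG'⟩ =>
    ⟨fun x => F x * G x, hF.mul hG, fun x => by simp [hF', hG']⟩
  add_mem' := fun ⟨F, hF, hF'⟩ ⟨G, hG, hG'⟩ =>
    ⟨fun x => F x + G x, hF.add hG, fun x => by simp [hF', hG']⟩
  algebraMap_mem' := fun r => ⟨fun _ => r, contDiffOn_const, fun _ => rfl⟩

namespace smoothRing

variable {U : TopologicalSpace.Opens Pt}

/-- Evaluation at a point. -/
def ev (x : U) : smoothRing U →ₐ[ℝ] ℝ := (Pi.evalAlgHom ℝ (fun _ => ℝ) x).comp (smoothRing U).val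

theorem ext_ev {a b : smoothRing U} (h : ∀ x, ev x a = ev x b) : a = b :=
  Subtype.ext (funext h)

/-- The restriction of a function that is smooth on `U`. -/
def ofFun (φ : Pt → ℝ) (h : ContDiffOn ℝ ∞ φ U) : smoothRing U := ⟨fun x => φ x, φ, h, fun _ => rfl⟩

theorem ev_ofFun {φ : Pt → ℝ} (h : ContDiffOn ℝ ∞ φ U) (x : U) : ev x (ofFun φ h) = φ x := rfl

/-- An extension to the whole space. -/
def lift (a : smoothRing U) : Pt → ℝ := a.2.choose

theorem contDiffOn_lift (a : smoothRing U) : ContDiffOn ℝ ∞ (lift a) U := a.2.choose_spec.1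

theorem lift_apply (a : smoothRing U) (x : U) : lift a x = ev x a := a.2.choose_spec.2 x

theorem differentiableAt_lift (a : smoothRing U) (x : U) : DifferentiableAt ℝ (lift a) x :=
  ((contDiffOn_lift a).contDiffAt (U.isOpen.mem_nhds x.2)).differentiableAt (by simp)

/-- On an open set a partial derivative sees only the values there, so the chosen extension is
immaterial. -/
theorem pd_lift {a : smoothRing U} {φ : Pt → ℝ} (h : ∀ x : U, φ x = ev x a) (μ : Fin 4) (x : U) :
    pd μ φ x = pd μ (lift a) x :=
  pd_congr U.isOpen (fun y hy => by rw [h ⟨y, hy⟩, lift_apply a ⟨y, hy⟩]) μ x.2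

/-- The partial derivative of a smooth function. -/
def pder (μ : Fin 4) (a : smoothRing U) : smoothRing U :=
  ofFun (pd μ (lift a)) (contDiffOn_pd U.isOpen (contDiffOn_lift a) μ)

theorem ev_pder {a : smoothRing U} {φ : Pt → ℝ} (h : ∀ x : U, φ x = ev x a) (μ : Fin 4) (x : U) :
    ev x (pder μ a) = pd μ φ x := (pd_lift h μ x).symm

theorem pder_add (μ : Fin 4) (a b : smoothRing U) : pder μ (a + b) = pder μ a + pder μ b :=
  ext_ev fun x => by
    rw [map_add, ev_pder (φ := fun y => lift a y + lift b y)
      (fun y => by rw [lift_apply, lift_apply, map_add]), ev_pder (lift_apply a),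
      ev_pder (lift_apply b), pd, fderiv_fun_add (differentiableAt_lift a x)
      (differentiableAt_lift b x)]
    rfl

theorem pder_smul (μ : Fin 4) (r : ℝ) (a : smoothRing U) : pder μ (r • a) = r • pder μ a :=
  ext_ev fun x => by
    rw [map_smul, ev_pder (φ := fun y => r * lift a y)
      (fun y => by rw [lift_apply, map_smul, smul_eq_mul]), ev_pder (lift_apply a), pd,
      fderiv_const_mul (differentiableAt_lift a x)]
    rfl

theorem pder_mul (μ : Fin 4) (a b : smoothRing U) :
    pder μ (a * b) = a * pder μ b + b * pder μ a :=
  ext_ev fun x => by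
    rw [map_add, map_mul, map_mul, ev_pder (φ := fun y => lift a y * lift b y)
      (fun y => by rw [lift_apply, lift_apply, map_mul]), ev_pder (lift_apply a),
      ev_pder (lift_apply b), pd, fderiv_fun_mul (differentiableAt_lift a x)
      (differentiableAt_lift b x), lift_apply, lift_apply]
    rfl

/-- The partial derivative as a derivation. -/
def d (μ : Fin 4) : Derivation ℝ (smoothRing U) (smoothRing U) :=
  Derivation.mk' { toFun := pder μ, map_add' := pder_add μ, map_smul' := pder_smul μ } (pder_mul μ)

theorem ev_d {a : smoothRing U} {φ : Pt → ℝ} (h : ∀ x : U, φ x = ev x a) (μ : Fin 4) (x : U) :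
    pd μ φ x = ev x (d μ a) := (ev_pder h μ x).symm

theorem d_comm (μ ν : Fin 4) (a : smoothRing U) : d μ (d ν a) = d ν (d μ a) :=
  ext_ev fun x => by
    have h : ∀ ν, ∀ y : U, pd ν (lift a) y = ev y (d ν a) := fun ν => ev_d (lift_apply a) ν
    rw [← ev_d (h ν), ← ev_d (h μ), pd_comm U.isOpen (contDiffOn_lift a) μ ν x.2]

theorem isUnit_of_ev_ne_zero {a : smoothRing U} (h : ∀ x, ev x a ≠ 0) : IsUnit a := by
  refine IsUnit.of_mul_eq_one (ofFun (fun x => (lift a x)⁻¹) ((contDiffOn_lift a).inv fun x hx => ?_))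
    (ext_ev fun x => ?_)
  · rw [lift_apply a ⟨x, hx⟩]; exact h _
  · rw [map_mul, ev_ofFun, lift_apply, map_one, mul_inv_cancel₀ (h x)]

end smoothRing

open smoothRing

/-- A smooth tetrad and a smooth Lorentz matrix field on an open set. -/
structure SmoothTetrad (U : TopologicalSpace.Opens Pt) where
  h : MatField
  Λ : MatField
  h_smooth : ∀ A μ, ContDiffOn ℝ ∞ (fun x => h x A μ) U
  h_det : ∀ x ∈ U, (h x).det ≠ 0
  Λ_smooth : ∀ A C, ContDiffOn ℝ ∞ (fun x => Λ x A C) U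
  lorentz : IsLorentzOn Λ U

theorem eta_transpose : etaᵀ = eta := Matrix.diagonal_transpose _

theorem eta_mul_eta : eta * eta = 1 := by
  rw [eta, Matrix.diagonal_mul_diagonal, ← Matrix.diagonal_one]
  congr 1
  ext i
  fin_cases i <;> simp

/-! ### Coordinate expressions as values of ring elements -/

namespace SmoothTetrad

variable {U : TopologicalSpace.Opens Pt} (s : SmoothTetrad U)

/-- The Minkowski metric as a constant matrix field. -/
def η (U : TopologicalSpace.Opens Pt) : Matrix (Fin 4) (Fin 4) (smoothRing U) :=
  eta.map (algebraMap ℝ (smoothRing U))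

theorem map_η (x : U) : (η U).map (ev x) = eta := by
  ext i j; simp [η]

theorem ext_map {M N : Matrix (Fin 4) (Fin 4) (smoothRing U)}
    (h : ∀ x, M.map (ev x) = N.map (ev x)) : M = N := by
  ext1 i j
  exact ext_ev fun x => congrFun (congrFun (h x) i) j

theorem map_mul (M N : Matrix (Fin 4) (Fin 4) (smoothRing U)) (x : U) :
    (M * N).map (ev x) = M.map (ev x) * N.map (ev x) := Matrix.map_mul

theorem map_one (x : U) : (1 : Matrix (Fin 4) (Fin 4) (smoothRing U)).map (ev x) = 1 := by
  simp

/-- The tetrad over the ring of smooth functions. -/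
def hMat : Matrix (Fin 4) (Fin 4) (smoothRing U) := Matrix.of fun A μ => ofFun _ (s.h_smooth A μ)

/-- The Lorentz matrix over the ring of smooth functions. -/
def ΛMat : Matrix (Fin 4) (Fin 4) (smoothRing U) := Matrix.of fun A C => ofFun _ (s.Λ_smooth A C)

theorem map_hMat (x : U) : s.hMat.map (ev x) = s.h x := rfl

theorem map_ΛMat (x : U) : s.ΛMat.map (ev x) = s.Λ x := rfl

theorem ev_det (x : U) : ev x s.hMat.det = (s.h x).det := by
  rw [← s.map_hMat, ← AlgHom.mapMatrix_apply, AlgHom.map_det]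

theorem isUnit_det : IsUnit s.hMat.det :=
  isUnit_of_ev_ne_zero fun x => by rw [ev_det]; exact s.h_det x x.2

theorem η_mul_η : η U * η U = 1 := ext_map fun x => by
  rw [map_mul, map_η, eta_mul_eta, map_one]

theorem η_transpose : (η U)ᵀ = η U := by
  rw [η, ← Matrix.transpose_map, eta_transpose]

theorem ΛMat_lorentz : s.ΛMatᵀ * η U * s.ΛMat = η U := ext_map fun x => by
  rw [map_mul, map_mul, Matrix.transpose_map, map_ΛMat, map_η, s.lorentz x x.2]

theorem inv_mul_ΛMat : (η U * s.ΛMatᵀ * η U) * s.ΛMat = 1 := by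
  rw [mul_assoc, mul_assoc, ← mul_assoc s.ΛMatᵀ, ΛMat_lorentz, η_mul_η]

theorem ΛMat_mul_inv : s.ΛMat * (η U * s.ΛMatᵀ * η U) = 1 := mul_eq_one_comm.1 s.inv_mul_ΛMat

/-- The tetrad data over the ring of smooth functions. -/
def tetrad : TetradPair (smoothRing.d (U := U)) where
  η := η U
  h := s.hMat
  hi := s.hMat⁻¹
  L := s.ΛMat
  -- The Lorentz condition gives the inverse as a polynomial in the entries, so its smoothness is
  -- automatic.
  Li := η U * s.ΛMatᵀ * η U
  comm := d_comm
  η_symm := η_transpose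
  η_sq := η_mul_η
  η_const μ := by ext1 i j; exact (smoothRing.d μ).map_algebraMap (eta i j)
  h_mul_hi := Matrix.mul_nonsing_inv _ s.isUnit_det
  L_mul_Li := s.ΛMat_mul_inv
  lorentz := by
    calc (η U * s.ΛMatᵀ * η U)ᵀ * η U * (η U * s.ΛMatᵀ * η U)
        = η U * s.ΛMat * η U * (η U * η U) * s.ΛMatᵀ * η U := by
          rw [Matrix.transpose_mul, Matrix.transpose_mul, Matrix.transpose_transpose, η_transpose]
          noncomm_ring
      _ = η U * (s.ΛMat * (η U * s.ΛMatᵀ * η U)) := by rw [η_mul_η]; noncomm_ring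
      _ = η U := by rw [ΛMat_mul_inv, mul_one]

/-- The pair of connections over the ring of smooth functions. -/
abbrev conn : ConnectionPair (smoothRing.d (U := U)) := s.tetrad.toConnectionPair

theorem ev_h (i j : Fin 4) (x : U) : s.h x i j = ev x (s.tetrad.h i j) := rfl

theorem ev_Λ (i j : Fin 4) (x : U) : s.Λ x i j = ev x (s.tetrad.L i j) := rfl

theorem inv_apply_of_mul_eq_one {M N : Matrix (Fin 4) (Fin 4) (smoothRing U)} (h : M * N = 1)
    {M' : Matrix (Fin 4) (Fin 4) ℝ} {x : U} (hM : M' = M.map (ev x)) (i j : Fin 4) :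
    M'⁻¹ i j = ev x (N i j) := by
  rw [Matrix.inv_eq_right_inv (B := N.map (ev x)) (by rw [hM, ← map_mul, h, map_one]),
    Matrix.map_apply]

theorem ev_hi (i j : Fin 4) (x : U) : (s.h x)⁻¹ i j = ev x (s.tetrad.hi i j) :=
  inv_apply_of_mul_eq_one s.tetrad.h_mul_hi rfl i j

theorem ev_Li (i j : Fin 4) (x : U) : (s.Λ x)⁻¹ i j = ev x (s.tetrad.Li i j) :=
  inv_apply_of_mul_eq_one s.tetrad.L_mul_Li rfl i j

theorem metric_eq_map (x : U) : metric s.h x = s.conn.g.map (ev x) := by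
  change _ = (s.hMatᵀ * η U * s.hMat).map (ev x)
  rw [map_mul, map_mul, Matrix.transpose_map, map_hMat, map_η, metric]

theorem ev_metric (i j : Fin 4) (x : U) : metric s.h x i j = ev x (s.conn.g i j) := by
  rw [metric_eq_map, Matrix.map_apply]

theorem ev_invMetric (i j : Fin 4) (x : U) : invMetric s.h x i j = ev x (s.conn.gi i j) :=
  inv_apply_of_mul_eq_one s.conn.g_mul_gi (s.metric_eq_map x) i j

theorem pd_metric (i j μ : Fin 4) (x : U) :
    pd μ (fun y => metric s.h y i j) x = ev x (d μ (s.conn.g i j)) :=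
  ev_d (φ := fun y => metric s.h y i j) (s.ev_metric i j) μ x

theorem pd_h (i j μ : Fin 4) (x : U) :
    pd μ (fun y => s.h y i j) x = ev x (d μ (s.tetrad.h i j)) :=
  ev_d (φ := fun y => s.h y i j) (s.ev_h i j) μ x

theorem pd_Li (i j μ : Fin 4) (x : U) :
    pd μ (fun y => (s.Λ y)⁻¹ i j) x = ev x (d μ (s.tetrad.Li i j)) :=
  ev_d (φ := fun y => (s.Λ y)⁻¹ i j) (s.ev_Li i j) μ x

theorem ev_half (x : U) : ev x (algebraMap ℝ _ (1 / 2)) = 1 / 2 := AlgHom.commutes _ _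

theorem ev_christoffel (σ μ ν : Fin 4) (x : U) :
    christoffel s.h σ μ ν x = ev x (s.conn.Γ μ σ ν) := by
  change _ = ev x (∑ ρ, algebraMap ℝ _ (1 / 2) * s.conn.gi σ ρ *
    (d μ (s.conn.g ρ ν) + d ν (s.conn.g ρ μ) - d ρ (s.conn.g μ ν)))
  simp only [christoffel, pd_metric, ev_invMetric, _root_.map_mul, map_add, map_sub,
    map_sum, ev_half]

theorem ev_riemann (ρ σ μ ν : Fin 4) (x : U) :
    riemann s.h ρ σ μ ν x = ev x (s.conn.R μ ν ρ σ) := by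
  simp only [riemann, ConnectionPair.R_apply, ev_d (s.ev_christoffel _ _ _), ev_christoffel,
    _root_.map_mul, map_add, map_sub, map_sum]

theorem ev_ricci (μ ν : Fin 4) (x : U) : ricci s.h μ ν x = ev x (s.conn.ric μ ν) := by
  simp only [ricci, ConnectionPair.ric_apply, ev_riemann, map_sum]

theorem ev_ricciScalar (x : U) : ricciScalar s.h x = ev x s.conn.scal := by
  simp only [ricciScalar, ConnectionPair.scal_eq, ev_ricci, ev_invMetric, _root_.map_mul, map_sum]

variable {φ : Pt → ℝ} {a : smoothRing U}

theorem ev_hess (hφ : ∀ x : U, φ x = ev x a) (μ ν : Fin 4) (x : U) :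
    Teleparallel.hess s.h φ μ ν x = ev x (s.conn.hess a μ ν) := by
  simp only [Teleparallel.hess, ConnectionPair.hess, Matrix.of_apply, ev_d (ev_d hφ _), ev_d hφ,
    ev_christoffel, _root_.map_mul, map_sub, map_sum]

theorem ev_box (hφ : ∀ x : U, φ x = ev x a) (x : U) : box s.h φ x = ev x (s.conn.box a) := by
  simp only [box, ConnectionPair.box_eq, s.ev_hess hφ, ev_invMetric, _root_.map_mul, map_sum]

theorem ev_gradUp (hφ : ∀ x : U, φ x = ev x a) (μ : Fin 4) (x : U) :
    gradUp s.h φ μ x = ev x (s.conn.grad a μ) := by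
  simp only [gradUp, ConnectionPair.grad, ev_d hφ, ev_invMetric, _root_.map_mul, map_sum]

theorem ev_spinConn (A D μ : Fin 4) (x : U) :
    spinConn s.Λ A D μ x = ev x ((s.tetrad.L * mder (d μ) s.tetrad.Li) A D) := by
  simp only [spinConn, Matrix.mul_apply, mder_apply, pd_Li, ev_Λ, _root_.map_mul,
    map_sum]

theorem ev_teleConn (σ ν μ : Fin 4) (x : U) :
    teleConn s.h s.Λ σ ν μ x = ev x (s.conn.W μ σ ν) := by
  change _ = ev x (s.tetrad.W μ σ ν)
  have h : ∀ A, (s.tetrad.L * mder (d μ) s.tetrad.Li * s.tetrad.h) A ν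
      = ∑ D, (s.tetrad.L * mder (d μ) s.tetrad.Li) A D * s.tetrad.h D ν :=
    fun A => Matrix.mul_apply
  rw [TetradPair.W, Matrix.mul_apply]
  simp only [teleConn, Matrix.add_apply, h, mder_apply, ev_spinConn,
    pd_h, ev_h, ev_hi, _root_.map_mul, map_add, map_sum]

theorem ev_torsion (ρ μ ν : Fin 4) (x : U) :
    torsion s.h s.Λ ρ μ ν x = ev x (s.conn.W μ ρ ν - s.conn.W ν ρ μ) := by
  simp only [torsion, ev_teleConn, map_sub]

theorem ev_contortionUp (μ ν ρ : Fin 4) (x : U) :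
    contortionUp s.h s.Λ μ ν ρ x = ev x (s.conn.κ ρ μ ν) := by
  simp only [contortionUp, contortion, ConnectionPair.κ_apply, ev_teleConn, ev_christoffel,
    ev_invMetric, _root_.map_mul, map_sub, map_sum]

theorem ev_torsionVec (μ : Fin 4) (x : U) : torsionVec s.h s.Λ μ x = ev x (s.conn.v μ) := by
  simp only [torsionVec, ← ConnectionPair.sum_gi_mul_vLow, ← ConnectionPair.sum_torsion_eq_vLow,
    ev_torsion, ev_invMetric, _root_.map_mul, map_sum]

theorem ev_superpot (ρ μ ν : Fin 4) (x : U) :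
    superpot s.h s.Λ ρ μ ν x = ev x (s.conn.S ρ μ ν) := by
  simp only [superpot, ConnectionPair.S, ev_contortionUp, ev_torsionVec, map_add, map_sub,
    apply_ite (ev x), map_zero]

theorem ev_torsionScalar (x : U) :
    torsionScalar s.h s.Λ x = ev x (algebraMap ℝ _ (1 / 2) * s.conn.twoT) := by
  simp only [torsionScalar, ConnectionPair.twoT, ev_superpot, ev_torsion, ev_half, _root_.map_mul,
    map_sum]

theorem ev_boundary (x : U) : boundary s.h s.Λ x = ev x (2 * s.conn.divV) := by
  have h1 : ∀ μ, ∀ y : U, (s.h y).det * torsionVec s.h s.Λ μ y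
      = ev y (s.tetrad.h.det * s.conn.v μ) := fun μ y => by
    have h : ev y s.tetrad.h.det = (s.h y).det := s.ev_det y
    rw [_root_.map_mul, ev_torsionVec, h]
  have h2 := s.conn.sum_deriv_mul_v s.tetrad.h.det s.tetrad.deriv_det
  have h3 : ev x s.tetrad.h.det = (s.h x).det := s.ev_det x
  simp only [boundary, ev_d (φ := fun y => (s.h y).det * torsionVec s.h s.Λ _ y) (h1 _)]
  rw [← map_sum, h2, _root_.map_mul, _root_.map_mul, h3, map_ofNat]
  have := s.h_det x x.2
  field_simp

theorem ev_superpotLow (μ ν α : Fin 4) (x : U) : superpotLow s.h s.Λ μ ν α x =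
    ev x (∑ σ, ∑ β, s.conn.g ν σ * s.conn.g α β * s.conn.S μ σ β) := by
  simp only [superpotLow, ev_superpot, ev_metric, _root_.map_mul, map_sum]

theorem ev_superpotUp (α μ ν : Fin 4) (x : U) : superpotUp s.h s.Λ α μ ν x =
    ev x (∑ ρ, s.conn.gi α ρ * s.conn.S ρ μ ν) := by
  simp only [superpotUp, ev_superpot, ev_invMetric, _root_.map_mul, map_sum]

end SmoothTetrad

theorem smoothRing.contDiffOn_of_ev {U : TopologicalSpace.Opens Pt} {φ : Pt → ℝ} {a : smoothRing U}
    (h : ∀ x : U, φ x = ev x a) : ContDiffOn ℝ ∞ φ U :=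
  (contDiffOn_lift a).congr fun x hx => by rw [h ⟨x, hx⟩, lift_apply a ⟨x, hx⟩]

theorem divSnd_congr {U : Set Pt} (hU : IsOpen U) (h : MatField) {E E' : Fin 4 → Fin 4 → Pt → ℝ}
    (hE : ∀ x ∈ U, ∀ μ ν, E μ ν x = E' μ ν x) {x : Pt} (hx : x ∈ U) (μ : Fin 4) :
    divSnd h E μ x = divSnd h E' μ x := by
  simp only [divSnd, covD, hE x hx, pd_congr hU (fun y hy => hE y hy _ _) _ hx]

theorem divFst_eq_divSnd {U : Set Pt} (hU : IsOpen U) (h : MatField)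
    {E : Fin 4 → Fin 4 → Pt → ℝ} (hE : ∀ x ∈ U, ∀ μ ν, E μ ν x = E ν μ x) {x : Pt} (hx : x ∈ U)
    (μ : Fin 4) : divFst h E μ x = divSnd h E μ x := by
  have : divFst h E μ x = divSnd h (fun μ ν => E ν μ) μ x := by
    simp only [divFst, divSnd, covD]
    exact Finset.sum_congr rfl fun ν _ => Finset.sum_congr rfl fun l _ => by ring
  rw [this]
  exact divSnd_congr hU h (fun x hx μ ν => hE x hx ν μ) hx μ

namespace SmoothTetrad

variable {U : TopologicalSpace.Opens Pt} (s : SmoothTetrad U)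

theorem ev_divSnd {E : Fin 4 → Fin 4 → Pt → ℝ} {M : Matrix (Fin 4) (Fin 4) (smoothRing U)}
    (hE : ∀ μ ν, ∀ x : U, E μ ν x = ev x (M μ ν)) (μ : Fin 4) (x : U) :
    divSnd s.h E μ x = ev x (s.conn.mdiv (M * s.conn.gi) μ) := by
  simp only [← ConnectionPair.sum_gi_mul_covD, divSnd, covD, ev_d (hE _ _), hE, ev_christoffel,
    ev_invMetric, _root_.map_mul, map_sub, map_sum]

theorem ev_sum_superpotLow {φ : Pt → ℝ} {a : smoothRing U} (hφ : ∀ x : U, φ x = ev x a)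
    (μ ν : Fin 4) (x : U) :
    ∑ α, superpotLow s.h s.Λ μ ν α x * gradUp s.h φ α x =
      ev x ((s.conn.SGrad a * s.conn.g) μ ν) := by
  simp only [ConnectionPair.SGrad_mul_g_apply, s.ev_gradUp hφ, ev_superpotLow, ← _root_.map_mul,
    ← map_sum]

theorem ev_gi_mul_SGrad {φ : Pt → ℝ} {a : smoothRing U} (hφ : ∀ x : U, φ x = ev x a)
    (α ρ : Fin 4) (x : U) :
    ∑ ν, superpotUp s.h s.Λ α ρ ν x * pd ν φ x = ev x ((s.conn.gi * s.conn.SGrad a) α ρ) := by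
  simp only [Matrix.mul_apply, ConnectionPair.SGrad_apply, ev_superpotUp, ev_d hφ,
    ← _root_.map_mul, ← map_sum]
  congr 1
  simp only [Finset.sum_mul, Finset.mul_sum]
  rw [Finset.sum_comm]
  exact Finset.sum_congr rfl fun i _ => Finset.sum_congr rfl fun j _ => by ring

/-- With `N` the contraction of the raised superpotential with ∂φ and `G` the metric at `x`, the
lowered contraction is `G * N * G`, symmetric whenever `N` is. Everything happens at one point. -/
theorem sum_superpotLow_symm {φ : Pt → ℝ} {a : smoothRing U} (hφ : ∀ x : U, φ x = ev x a) {x : U}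
    (h : ∀ α ρ, antisym s.h s.Λ φ α ρ x = 0) (μ ν : Fin 4) :
    ∑ α, superpotLow s.h s.Λ μ ν α x * gradUp s.h φ α x =
      ∑ α, superpotLow s.h s.Λ ν μ α x * gradUp s.h φ α x := by
  set N := (s.conn.gi * s.conn.SGrad a).map (ev x) with hN
  set G := s.conn.g.map (ev x) with hG
  have hNt : Nᵀ = N := by
    ext α ρ
    have h1 := h ρ α
    have h2 : antisym s.h s.Λ φ ρ α x = 1 / 2 * (∑ ν, superpotUp s.h s.Λ ρ α ν x * pd ν φ x
        - ∑ ν, superpotUp s.h s.Λ α ρ ν x * pd ν φ x) := by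
      rw [antisym, ← Finset.sum_sub_distrib, Finset.mul_sum]
      exact Finset.sum_congr rfl fun _ _ => by ring
    rw [h2, s.ev_gi_mul_SGrad hφ, s.ev_gi_mul_SGrad hφ] at h1
    rw [Matrix.transpose_apply, hN, Matrix.map_apply, Matrix.map_apply]
    linarith
  have hGt : Gᵀ = G := by rw [hG, ← Matrix.transpose_map, s.conn.g_symm]
  have hM : (s.conn.SGrad a * s.conn.g).map (ev x) = G * N * G := by
    rw [hG, hN, ← map_mul, ← map_mul, ← mul_assoc s.conn.g, s.conn.g_mul_gi, one_mul]
  have hMt : (G * N * G)ᵀ = G * N * G := by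
    rw [Matrix.transpose_mul, Matrix.transpose_mul, hGt, hNt, mul_assoc]
  rw [s.ev_sum_superpotLow hφ, s.ev_sum_superpotLow hφ]
  have := congrFun (congrFun hMt ν) μ
  rwa [← hM] at this

/-! ### The identities of f(T,B) gravity on U -/

section FieldTB

variable {V : Set (ℝ × ℝ)} {f : ℝ × ℝ → ℝ}

theorem contDiffOn_scalars :
    ContDiffOn ℝ ∞ (fun x => (torsionScalar s.h s.Λ x, boundary s.h s.Λ x)) U :=
  (contDiffOn_of_ev s.ev_torsionScalar).prodMk (contDiffOn_of_ev s.ev_boundary)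

theorem contDiffOn_fF (hf : ContDiffOn ℝ ∞ f V)
    (hTB : ∀ x ∈ U, (torsionScalar s.h s.Λ x, boundary s.h s.Λ x) ∈ V) :
    ContDiffOn ℝ ∞ (fF s.h s.Λ f) U := hf.comp s.contDiffOn_scalars hTB

theorem contDiffOn_fderiv_scalars (hV : IsOpen V) (hf : ContDiffOn ℝ ∞ f V)
    (hTB : ∀ x ∈ U, (torsionScalar s.h s.Λ x, boundary s.h s.Λ x) ∈ V) (p : ℝ × ℝ) :
    ContDiffOn ℝ ∞ (fun x => fderiv ℝ f (torsionScalar s.h s.Λ x, boundary s.h s.Λ x) p) U :=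
  ((hf.fderiv_of_isOpen hV (m := ∞) (by simp)).comp s.contDiffOn_scalars hTB).clm_apply
    contDiffOn_const

theorem pd_fF (hV : IsOpen V) (hf : ContDiffOn ℝ ∞ f V)
    (hTB : ∀ x ∈ U, (torsionScalar s.h s.Λ x, boundary s.h s.Λ x) ∈ V) (μ : Fin 4) (x : U) :
    pd μ (fF s.h s.Λ f) x = fT s.h s.Λ f x * pd μ (torsionScalar s.h s.Λ) x
      + fB s.h s.Λ f x * pd μ (boundary s.h s.Λ) x := by
  have hdiff : ∀ {φ : Pt → ℝ}, ContDiffOn ℝ ∞ φ U → DifferentiableAt ℝ φ x := fun h =>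
    (h.contDiffAt (U.isOpen.mem_nhds x.2)).differentiableAt (by simp)
  have hT := (hdiff (contDiffOn_of_ev s.ev_torsionScalar)).hasFDerivAt
  have hB := (hdiff (contDiffOn_of_ev s.ev_boundary)).hasFDerivAt
  have hfx : DifferentiableAt ℝ f (torsionScalar s.h s.Λ x, boundary s.h s.Λ x) :=
    (hf.contDiffAt (hV.mem_nhds (hTB x x.2))).differentiableAt (by simp)
  have h := (hfx.hasFDerivAt.comp (x : Pt) (hT.prodMk hB)).fderiv
  have h' : fderiv ℝ (fF s.h s.Λ f) x = _ := h
  rw [pd, h']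
  set a := pd μ (torsionScalar s.h s.Λ) x with ha
  set b := pd μ (boundary s.h s.Λ) x with hb
  change fderiv ℝ f (torsionScalar s.h s.Λ x, boundary s.h s.Λ x) (a, b) = _
  have hab : (a, b) = a • ((1 : ℝ), (0 : ℝ)) + b • ((0 : ℝ), (1 : ℝ)) := by simp
  rw [hab, map_add, map_smul, map_smul, fT, fB, smul_eq_mul, smul_eq_mul]
  ring

theorem exists_ev_fieldTB (hV : IsOpen V) (hf : ContDiffOn ℝ ∞ f V)
    (hTB : ∀ x ∈ U, (torsionScalar s.h s.Λ x, boundary s.h s.Λ x) ∈ V) :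
    ∃ a aT aB : smoothRing U,
      (∀ x : U, fTB s.h s.Λ f x = ev x (aT + aB)) ∧
      (∀ μ ν, ∀ x : U, fieldTB s.h s.Λ f μ ν x = ev x (s.conn.field a aT aB μ ν)) ∧
      ∀ μ, d μ a = aT * d μ (algebraMap ℝ _ (1 / 2) * s.conn.twoT) + aB * d μ (2 * s.conn.divV) := by
  let a : smoothRing U := ofFun _ (s.contDiffOn_fF hf hTB)
  let aT : smoothRing U := ofFun _ (s.contDiffOn_fderiv_scalars hV hf hTB (1, 0))
  let aB : smoothRing U := ofFun _ (s.contDiffOn_fderiv_scalars hV hf hTB (0, 1))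
  have ha : ∀ x : U, fF s.h s.Λ f x = ev x a := fun x => rfl
  have haT : ∀ x : U, fT s.h s.Λ f x = ev x aT := fun x => rfl
  have haB : ∀ x : U, fB s.h s.Λ f x = ev x aB := fun x => rfl
  -- From here only the pointwise values and the chain rule matter, so the ring elements are made
  -- opaque.
  clear_value a aT aB
  have haTB : ∀ x : U, fTB s.h s.Λ f x = ev x (aT + aB) := fun x => by
    rw [fTB, haT, haB, map_add]
  refine ⟨a, aT, aB, haTB, fun μ ν x => ?_, fun μ => ext_ev fun x => ?_⟩
  · simp only [ConnectionPair.field, ConnectionPair.fieldSymm, Matrix.add_apply, Matrix.sub_apply,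
      Matrix.smul_apply, smul_eq_mul, _root_.map_mul, map_add, map_sub, map_ofNat]
    rw [fieldTB, s.ev_sum_superpotLow haTB, s.ev_box haB, s.ev_hess haB, ha, haT, haB,
      ev_torsionScalar, ev_boundary, einstein, ev_ricci, ev_ricciScalar, ev_metric]
    simp only [_root_.map_mul, ev_half, map_ofNat]
    ring
  · rw [map_add, _root_.map_mul (ev x) aT, _root_.map_mul (ev x) aB, ← ev_d ha, s.pd_fF hV hf hTB, haT, haB,
      ev_d s.ev_torsionScalar, ev_d s.ev_boundary]

theorem fieldTB_sub_swap (hV : IsOpen V) (hf : ContDiffOn ℝ ∞ f V)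
    (hTB : ∀ x ∈ U, (torsionScalar s.h s.Λ x, boundary s.h s.Λ x) ∈ V) (x : U) (μ ν : Fin 4) :
    fieldTB s.h s.Λ f μ ν x - fieldTB s.h s.Λ f ν μ x =
      ∑ α, (superpotLow s.h s.Λ μ ν α x - superpotLow s.h s.Λ ν μ α x) *
        gradUp s.h (fTB s.h s.Λ f) α x := by
  obtain ⟨a, aT, aB, haTB, hE, -⟩ := s.exists_ev_fieldTB hV hf hTB
  have h := congrFun (congrFun (s.conn.fieldSymm_transpose a aT aB) ν) μ
  rw [Matrix.transpose_apply] at h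
  simp only [sub_mul, Finset.sum_sub_distrib]
  rw [s.ev_sum_superpotLow haTB, s.ev_sum_superpotLow haTB, hE, hE, ConnectionPair.field,
    Matrix.add_apply, Matrix.add_apply, h, map_add, map_add]
  ring

theorem fieldTB_symm (hV : IsOpen V) (hf : ContDiffOn ℝ ∞ f V)
    (hTB : ∀ x ∈ U, (torsionScalar s.h s.Λ x, boundary s.h s.Λ x) ∈ V) {x : U}
    (h : ∀ α ρ, antisym s.h s.Λ (fTB s.h s.Λ f) α ρ x = 0) (μ ν : Fin 4) :
    fieldTB s.h s.Λ f μ ν x = fieldTB s.h s.Λ f ν μ x := by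
  obtain ⟨a, aT, aB, haTB, -, -⟩ := s.exists_ev_fieldTB hV hf hTB
  rw [← sub_eq_zero, s.fieldTB_sub_swap hV hf hTB]
  simp only [sub_mul, Finset.sum_sub_distrib]
  rw [s.sum_superpotLow_symm haTB h, sub_self]

theorem divSnd_fieldTB (hV : IsOpen V) (hf : ContDiffOn ℝ ∞ f V)
    (hTB : ∀ x ∈ U, (torsionScalar s.h s.Λ x, boundary s.h s.Λ x) ∈ V) (x : U) (μ : Fin 4) :
    divSnd s.h (fieldTB s.h s.Λ f) μ x =
      ∑ α, ∑ β, contortionUp s.h s.Λ α β μ x * fieldTB s.h s.Λ f α β x := by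
  obtain ⟨a, aT, aB, -, hE, hd⟩ := s.exists_ev_fieldTB hV hf hTB
  rw [s.ev_divSnd hE, ConnectionPair.mdiv_field _ _ _ _ _ (hd μ)]
  simp only [hE, ev_contortionUp, _root_.map_mul, map_sum]

theorem divSnd_fieldTB_eq_zero (hV : IsOpen V) (hf : ContDiffOn ℝ ∞ f V)
    (hTB : ∀ x ∈ U, (torsionScalar s.h s.Λ x, boundary s.h s.Λ x) ∈ V) {x : U}
    (h : ∀ α ρ, antisym s.h s.Λ (fTB s.h s.Λ f) α ρ x = 0) (μ : Fin 4) :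
    divSnd s.h (fieldTB s.h s.Λ f) μ x = 0 := by
  rw [s.divSnd_fieldTB hV hf hTB]
  refine sum_antisymm_mul_symm (fun i j => ?_) (s.fieldTB_symm hV hf hTB h)
  rw [ev_contortionUp, ev_contortionUp, ConnectionPair.κ_antisymm, map_neg]

/-- The first-index divergence differentiates the transposed tensor, so symmetry at a single point
would not suffice for this argument; it is used throughout U. -/
theorem div_fieldTB_eq_zero (hV : IsOpen V) (hf : ContDiffOn ℝ ∞ f V)
    (hTB : ∀ x ∈ U, (torsionScalar s.h s.Λ x, boundary s.h s.Λ x) ∈ V)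
    (h : ∀ x ∈ U, ∀ α ρ, antisym s.h s.Λ (fTB s.h s.Λ f) α ρ x = 0) (x : U) (μ : Fin 4) :
    divSnd s.h (fieldTB s.h s.Λ f) μ x = 0 ∧ divFst s.h (fieldTB s.h s.Λ f) μ x = 0 := by
  have h1 := s.divSnd_fieldTB_eq_zero hV hf hTB (h x x.2) μ
  refine ⟨h1, ?_⟩
  rw [divFst_eq_divSnd U.isOpen s.h
    (fun y hy => s.fieldTB_symm (x := ⟨y, hy⟩) hV hf hTB (h y hy)) x.2, h1]

end FieldTB

/-! ### Specialization to f(T) gravity -/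

section FieldT

variable {V : Set ℝ} {F : ℝ → ℝ}

theorem fT_comp_fst (hV : IsOpen V) (hF : ContDiffOn ℝ ∞ F V) {x : Pt}
    (hT : torsionScalar s.h s.Λ x ∈ V) (p : ℝ × ℝ) :
    fderiv ℝ (fun q : ℝ × ℝ => F q.1) (torsionScalar s.h s.Λ x, boundary s.h s.Λ x) p
      = dF s.h s.Λ F x * p.1 := by
  have h : DifferentiableAt ℝ F (torsionScalar s.h s.Λ x) :=
    (hF.contDiffAt (hV.mem_nhds hT)).differentiableAt (by simp)
  have h1 : HasFDerivAt (fun q : ℝ × ℝ => F q.1) _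
      (torsionScalar s.h s.Λ x, boundary s.h s.Λ x) :=
    HasFDerivAt.comp (g := F) _ h.hasDerivAt.hasFDerivAt hasFDerivAt_fst
  rw [h1.fderiv]
  simp [dF, mul_comm]

theorem fTB_comp_fst (hV : IsOpen V) (hF : ContDiffOn ℝ ∞ F V) {x : Pt}
    (hT : torsionScalar s.h s.Λ x ∈ V) : fTB s.h s.Λ (fun q => F q.1) x = dF s.h s.Λ F x := by
  rw [fTB, fT, fB, s.fT_comp_fst hV hF hT, s.fT_comp_fst hV hF hT]
  simp

theorem antisym_comp_fst (hV : IsOpen V) (hF : ContDiffOn ℝ ∞ F V)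
    (hT : ∀ x ∈ U, torsionScalar s.h s.Λ x ∈ V) (x : U) (α ρ : Fin 4) :
    antisym s.h s.Λ (fTB s.h s.Λ (fun q => F q.1)) α ρ x
      = antisym s.h s.Λ (dF s.h s.Λ F) α ρ x := by
  simp only [antisym, pd_congr U.isOpen (fun y hy => s.fTB_comp_fst hV hF (hT y hy)) _ x.2]

/-- For f(T,B) = F(T) the field f_B vanishes on U, and with it the second-derivative terms and the B
term. -/
theorem fieldTB_comp_fst (hV : IsOpen V) (hF : ContDiffOn ℝ ∞ F V)
    (hT : ∀ x ∈ U, torsionScalar s.h s.Λ x ∈ V) (μ ν : Fin 4) (x : U) :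
    fieldTB s.h s.Λ (fun q => F q.1) μ ν x = fieldT s.h s.Λ F μ ν x := by
  have hB : ∀ x : U, fB s.h s.Λ (fun q => F q.1) x = ev x 0 := fun x => by
    rw [fB, s.fT_comp_fst hV hF (hT x x.2)]; simp
  have hTx : fT s.h s.Λ (fun q => F q.1) x = dF s.h s.Λ F x := by
    rw [fT, s.fT_comp_fst hV hF (hT x x.2)]; simp
  have hh : s.conn.hess (0 : smoothRing U) = 0 := by ext1 i j; simp [ConnectionPair.hess]
  rw [fieldTB, fieldT, s.ev_box hB, s.ev_hess hB, ConnectionPair.box, hh, hTx, hB, fF]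
  simp only [gradUp, pd_congr U.isOpen (fun y hy => s.fTB_comp_fst hV hF (hT y hy)) _ x.2]
  simp

end FieldT

end SmoothTetrad

end Teleparallel

end

theorem mainTheorem2
    (U : Set Teleparallel.Pt) (hU : IsOpen U)
    (h Λ : Teleparallel.MatField)
    (hh : ∀ A μ, ContDiffOn ℝ ∞ (fun x => h x A μ) U)
    (hdet : ∀ x ∈ U, (h x).det ≠ 0)
    (hΛ : ∀ A C, ContDiffOn ℝ ∞ (fun x => Λ x A C) U)
    (hLor : Teleparallel.IsLorentzOn Λ U) :
    -- f(T,B) gravity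
    (∀ (V : Set (ℝ × ℝ)) (f : ℝ × ℝ → ℝ), IsOpen V → ContDiffOn ℝ ∞ f V →
      (∀ x ∈ U, (Teleparallel.torsionScalar h Λ x, Teleparallel.boundary h Λ x) ∈ V) →
      -- only the last term of the field equations has an antisymmetric part
      (∀ x ∈ U, ∀ μ ν,
        Teleparallel.fieldTB h Λ f μ ν x - Teleparallel.fieldTB h Λ f ν μ x =
          ∑ α, (Teleparallel.superpotLow h Λ μ ν α x - Teleparallel.superpotLow h Λ ν μ α x) *
            Teleparallel.gradUp h (Teleparallel.fTB h Λ f) α x) ∧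
      -- the identity without any field equation
      (∀ x ∈ U, ∀ μ,
        Teleparallel.divSnd h (Teleparallel.fieldTB h Λ f) μ x =
          ∑ α, ∑ β, Teleparallel.contortionUp h Λ α β μ x *
            Teleparallel.fieldTB h Λ f α β x) ∧
      -- the divergence vanishes wherever the antisymmetric part does
      (∀ x ∈ U, (∀ α ρ, Teleparallel.antisym h Λ (Teleparallel.fTB h Λ f) α ρ x = 0) →
        ∀ μ, Teleparallel.divSnd h (Teleparallel.fieldTB h Λ f) μ x = 0) ∧
      -- both divergences vanish if the antisymmetric part vanishes throughout the region
      ((∀ x ∈ U, ∀ α ρ, Teleparallel.antisym h Λ (Teleparallel.fTB h Λ f) α ρ x = 0) →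
        ∀ x ∈ U, ∀ μ,
          Teleparallel.divSnd h (Teleparallel.fieldTB h Λ f) μ x = 0 ∧
          Teleparallel.divFst h (Teleparallel.fieldTB h Λ f) μ x = 0)) ∧
    -- the special case of f(T) gravity
    (∀ (V : Set ℝ) (F : ℝ → ℝ), IsOpen V → ContDiffOn ℝ ∞ F V →
      (∀ x ∈ U, Teleparallel.torsionScalar h Λ x ∈ V) →
      (∀ x ∈ U, (∀ α ρ, Teleparallel.antisym h Λ (Teleparallel.dF h Λ F) α ρ x = 0) →
        ∀ μ, Teleparallel.divSnd h (Teleparallel.fieldT h Λ F) μ x = 0) ∧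
      ((∀ x ∈ U, ∀ α ρ, Teleparallel.antisym h Λ (Teleparallel.dF h Λ F) α ρ x = 0) →
        ∀ x ∈ U, ∀ μ,
          Teleparallel.divSnd h (Teleparallel.fieldT h Λ F) μ x = 0 ∧
          Teleparallel.divFst h (Teleparallel.fieldT h Λ F) μ x = 0)) := by
  let s : Teleparallel.SmoothTetrad ⟨U, hU⟩ := ⟨h, Λ, hh, hdet, hΛ, hLor⟩
  refine ⟨fun V f hV hf hTB => ⟨fun x hx => s.fieldTB_sub_swap hV hf hTB ⟨x, hx⟩,
    fun x hx => s.divSnd_fieldTB hV hf hTB ⟨x, hx⟩,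
    fun x hx h0 => s.divSnd_fieldTB_eq_zero (x := ⟨x, hx⟩) hV hf hTB h0,
    fun h0 x hx => s.div_fieldTB_eq_zero hV hf hTB h0 ⟨x, hx⟩⟩, fun V F hV hF hT => ?_⟩
  -- F is viewed as a function of (T,B) independent of B, hence with no constraint on B.
  have hV' : IsOpen (V ×ˢ (Set.univ : Set ℝ)) := hV.prod isOpen_univ
  have hf : ContDiffOn ℝ ∞ (fun q : ℝ × ℝ => F q.1) (V ×ˢ Set.univ) :=
    hF.comp contDiffOn_fst fun q hq => hq.1
  have hTB : ∀ x ∈ U, (Teleparallel.torsionScalar h Λ x, Teleparallel.boundary h Λ x) ∈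
      V ×ˢ (Set.univ : Set ℝ) := fun x hx => ⟨hT x hx, trivial⟩
  have hE : ∀ x ∈ U, ∀ μ ν, Teleparallel.fieldT h Λ F μ ν x =
      Teleparallel.fieldTB h Λ (fun q => F q.1) μ ν x := fun x hx μ ν =>
    (s.fieldTB_comp_fst hV hF hT μ ν ⟨x, hx⟩).symm
  have ha : ∀ x ∈ U, ∀ α ρ, Teleparallel.antisym h Λ (Teleparallel.fTB h Λ fun q => F q.1) α ρ x =
      Teleparallel.antisym h Λ (Teleparallel.dF h Λ F) α ρ x := fun x hx =>
    s.antisym_comp_fst hV hF hT ⟨x, hx⟩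
  have hdiv : ∀ x ∈ U, (∀ α ρ, Teleparallel.antisym h Λ (Teleparallel.dF h Λ F) α ρ x = 0) →
      ∀ μ, Teleparallel.divSnd h (Teleparallel.fieldT h Λ F) μ x = 0 := fun x hx h0 μ => by
    rw [Teleparallel.divSnd_congr hU h hE hx]
    exact s.divSnd_fieldTB_eq_zero (x := ⟨x, hx⟩) hV' hf hTB
      (fun α ρ => (ha x hx α ρ).trans (h0 α ρ)) μ
  refine ⟨hdiv, fun h0 x hx μ => ⟨hdiv x hx (h0 x hx) μ, ?_⟩⟩
  rw [Teleparallel.divFst_eq_divSnd hU h (fun y hy μ ν => ?_) hx, hdiv x hx (h0 x hx) μ]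
  rw [hE y hy, hE y hy]
  exact s.fieldTB_symm (x := ⟨y, hy⟩) hV' hf hTB
    (fun α ρ => (ha y hy α ρ).trans (h0 y hy α ρ)) μ ν
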